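/- \textbf{Theorem (Optimality of CPCTL-VI).} \emph{Setting.} Let $\mathcal M=(S,A,P,s_0,AP,L,R)$ be a labelled Markov decision process with a finite set $S$ of states, finite nonempty sets $A(s)$ of actions, transition probabilities $P(s'\mid s,a)$, initial state $s_0$, labelling $L:S\to 2^{AP}$ and reward $R:S\to\mathbb R$. A policy $\pi$ maps each finite history (a nonempty word of states) to a probability distribution over the actions available in its last state; $\mathcal M_\pi$ is the induced Markov chain on histories, with a history labelled as its last state, and $\mathcal M_\pi^s$ is this chain started in the history $s$ (so $\mathcal M_\pi=\mathcal M_\pi^{s_0}$). Formulas are interpreted in $\mathcal M_\pi$ by the usual semantics of PCTL, where $\xi\models\Phi_1\mathbf W\Phi_2$ means that $\Phi_1$ holds forever along $\xi$, or that $\Phi_2$ holds at some position and $\Phi_1$ holds up to it (included), and $\mathbf G\Phi=\Phi\,\mathbf W\bot$. CPCTL state formulas are given by $\Phi::=a\mid\neg a\mid\Phi\wedge\Phi\mid\mathbb P_{\ge q}[\Phi_1\mathbf W(\Phi_1\wedge\Phi_2)]$, $a\in AP$, $q\in[0,1]$. Fix such a $\Phi$. Let $\Phi_i$, $i\in SF(\Phi)$,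 be its state subformulas and $\phi_j=\Phi_{j_1}\mathbf W(\Phi_{j_1}\wedge\Phi_{j_2})$, $j\in PF(\Phi)$, its path subformulas, each taken with its threshold $p_j$, so that $\mathbb P_{\ge p_j}[\phi_j]$ is a state subformula of $\Phi$. \emph{Slater's generalized assumption.} There are thresholds $p'_j\in[0,1]$ with $p'_j>p_j$ for all $j\in PF(\Phi)$ and a policy $\pi$ such that $\mathcal M_\pi\models \mathtt T(\Phi,p')$, where $\mathtt T(\Phi,p')$ is $\Phi$ with every threshold $p_j$, nested ones included, replaced by $p'_j$. \emph{Value iteration.} A profile is a pair $(\mu,\nu)\in\{0,1\}^{SF(\Phi)}\times[0,1]^{PF(\Phi)}$; profiles are ordered componentwise. The literal projection is $\mathrm{alit}(a)=a$, $\mathrm{alit}(\neg a)=\neg a$, $\mathrm{alit}(\Phi_1\wedge\Phi_2)=\mathrm{alit}(\Phi_1)\wedge\mathrm{alit}(\Phi_2)$, and $\mathrm{alit}(\mathbb P_{\ge p}[\Phi_1\mathbf W(\Phi_1\wedge\Phi_2)])$ is $\top$ if $p=0$ and $\mathrm{alit}(\Phi_1)$ otherwise. The initial vector: $\mathcal I_{\mathcal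 M}(s)$ is the set of profiles $(\mu,\nu)$ such that for some policy $\pi$ and all $j$, $\nu_j=1$ if $\mathcal M_\pi^s\models\mathbb P_{\ge1}[\mathbf G\,\mathrm{alit}(\mathbb P_{\ge p_j}[\phi_j])]$ and $\nu_j=0$ otherwise, and such that $\mu$ is maximal among the valuations that are state compatible with $\nu$ at $s$, i.e. for which $\mu_i=1$ implies: $a\in L(s)$ if $\Phi_i=a$; $a\notin L(s)$ if $\Phi_i=\neg a$; $\mu_{i_1}=\mu_{i_2}=1$ if $\Phi_i=\Phi_{i_1}\wedge\Phi_{i_2}$; $\nu_j\ge p_j$ if $\Phi_i=\mathbb P_{\ge p_j}[\phi_j]$. The Bellman operator: $\mathcal B_\Phi[V](s)$ is the set of maximal elements of the set of all profiles $(\mu,\nu)$ for which there are a distribution $\delta$ over $A(s)$ and profiles $(\mu^{s'},\nu^{s'})\in V(s')$, $s'\in S$, such that: if $\Phi_i=a$ then $\mu_i=1$ iff $a\in L(s)$; if $\Phi_i=\neg a$ then $\mu_i=1$ iff $a\notin L(s)$; if $\Phi_i=\Phi_{i_1}\wedge\Phi_{i_2}$ then $\mu_i=\mu_{i_1}\mu_{i_2}$;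 if $\Phi_i=\mathbb P_{\ge p_j}[\phi_j]$ then $\mu_i=1$ iff $\nu_j\ge p_j$; and for all $j$, $\nu_j=0$ if $\mu_{j_1}=0$, $\nu_j=1$ if $\mu_{j_1}=\mu_{j_2}=1$, and $\nu_j=\sum_{a\in A(s),\,s'\in S}\delta(a)P(s'\mid s,a)\nu_j^{s'}$ otherwise. \emph{Claim.} Let $V_n=\mathcal B_\Phi^n[\mathcal I_{\mathcal M}]$. If $\mathcal M,\Phi$ satisfy Slater's generalized assumption, then there are $n_0\in\mathbb N$ and a profile $(\mu,\nu)\in V_{n_0}(s_0)$ such that $\nu_i\ge p_i$ for every top-level conjunct $\mathbb P_{\ge p_i}[\phi_i]$ of $\Phi$. Equivalently, the algorithm CPCTL-VI, which starts from $V=\mathcal I_{\mathcal M}$ and replaces $V$ by $\mathcal B_\Phi[V]$ as long as no profile in $V(s_0)$ meets all top-level thresholds, stops after finitely many iterations. -/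

import Mathlib

universe u

/-! ### PCTL: formulas and semantics over Markov chains -/

mutual
/-- State formulas of PCTL over the atomic propositions `AP`. -/
inductive PCTLState (AP : Type u) where
  | top : PCTLState AP
  | bot : PCTLState AP
  | atom (a : AP) : PCTLState AP
  | not (Φ : PCTLState AP) : PCTLState AP
  | and (Φ Ψ : PCTLState AP) : PCTLState AP
  | or (Φ Ψ : PCTLState AP) : PCTLState AP
  | prob (q : unitInterval) (φ : PCTLPath AP) : PCTLState AP
/-- Path formulas of PCTL: next, weak until, until. -/
inductive PCTLPath (AP : Type u) where
  | next (Φ : PCTLState AP) : PCTLPath AP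
  | weakUntil (Φ Ψ : PCTLState AP) : PCTLPath AP
  | until (Φ Ψ : PCTLState AP) : PCTLPath AP
end

/-- `G Φ`, as the abbreviation of `Φ W ⊥`. -/
def PCTLPath.globally {AP : Type*} (Φ : PCTLState AP) : PCTLPath AP :=
  .weakUntil Φ .bot

/-- A labelled Markov chain with state space `Q`. -/
structure MarkovChain (Q AP : Type*) where
  step : Q → PMF Q
  init : Q
  label : Q → Set AP

section Chain

variable {Q AP : Type*} [MeasurableSpace Q] [DiscreteMeasurableSpace Q]

/-- The transition kernel of the chain, as a kernel depending on the past `x 0, …, x n`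
through `x n` only. -/
noncomputable def MarkovChain.kernel (C : MarkovChain Q AP) (n : ℕ) :
    ProbabilityTheory.Kernel ((i : Finset.Iic n) → (fun _ : ℕ => Q) i) Q where
  toFun x := (C.step (x ⟨n, Finset.mem_Iic.2 le_rfl⟩)).toMeasure
  measurable' :=
    (Measurable.of_discrete (f := fun q : Q => (C.step q).toMeasure)).comp
      (measurable_pi_apply _)

instance MarkovChain.isMarkovKernel_kernel (C : MarkovChain Q AP) (n : ℕ) :
    ProbabilityTheory.IsMarkovKernel (C.kernel n) :=
  ⟨fun x => PMF.toMeasure.isProbabilityMeasure (C.step (x ⟨n, Finset.mem_Iic.2 le_rfl⟩))⟩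

/-- The law of the infinite path of the chain started in the state `q`. -/
noncomputable def MarkovChain.pathMeasure (C : MarkovChain Q AP) (q : Q) :
    MeasureTheory.Measure (ℕ → Q) :=
  ProbabilityTheory.Kernel.traj (X := fun _ => Q) C.kernel 0 (fun _ => q)

mutual
/-- `C.Sat Φ q` is `(C, q) ⊨ Φ`. -/
noncomputable def MarkovChain.Sat (C : MarkovChain Q AP) : PCTLState AP → Q → Prop
  | .top, _ => True
  | .bot, _ => False
  | .atom a, q => a ∈ C.label q
  | .not Φ, q => ¬ C.Sat Φ q
  | .and Φ Ψ, q => C.Sat Φ q ∧ C.Sat Ψ q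
  | .or Φ Ψ, q => C.Sat Φ q ∨ C.Sat Ψ q
  | .prob p φ, q => (p : ℝ) ≤ (C.pathMeasure q).real {ξ | C.PathSat φ ξ}
/-- `C.PathSat φ ξ` is `(C, ξ) ⊨ φ`. -/
noncomputable def MarkovChain.PathSat (C : MarkovChain Q AP) : PCTLPath AP → (ℕ → Q) → Prop
  | .next Φ, ξ => C.Sat Φ (ξ 1)
  | .until Φ Ψ, ξ => ∃ j, C.Sat Ψ (ξ j) ∧ ∀ i ≤ j, C.Sat Φ (ξ i)
  | .weakUntil Φ Ψ, ξ =>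
      (∃ j, C.Sat Ψ (ξ j) ∧ ∀ i ≤ j, C.Sat Φ (ξ i)) ∨ ∀ j, C.Sat Φ (ξ j)
end

/-- `C ⊨ Φ`: satisfaction in the initial state. -/
def MarkovChain.Models (C : MarkovChain Q AP) (Φ : PCTLState AP) : Prop :=
  C.Sat Φ C.init

end Chain

/-! ### Markov decision processes -/

/-- A labelled Markov decision process with states `S`, with `Act s` the type of the actions that
are available in `s`, and with atomic propositions `AP`. -/
structure MDP (S : Type*) (Act : S → Type*) (AP : Type*) where
  P : (s : S) → Act s → PMF S
  init : S
  label : S → Set AP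
  reward : S → ℝ

/-- A history: a nonempty word of states, split into its last letter and what comes before. -/
@[ext] structure History (S : Type*) where
  past : List S
  last : S

/-- The history that consists of the single state `s`. -/
def History.single {S : Type*} (s : S) : History S := ⟨[], s⟩

/-- The history `h` continued by the state `s`. -/
def History.snoc {S : Type*} (h : History S) (s : S) : History S := ⟨h.past ++ [h.last], s⟩

instance {S : Type*} : MeasurableSpace (History S) := ⊤

instance {S : Type*} : DiscreteMeasurableSpace (History S) := ⟨fun _ => trivial⟩

/-- History-dependent randomized policies. (They are also given values on words that are not
paths of an MDP; these are reached with probability `0`, and the values do not matter.) -/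
def Policy {S : Type*} (Act : S → Type*) := (h : History S) → PMF (Act h.last)

section MDP

variable {S AP : Type*} {Act : S → Type*}

/-- The Markov chain `M_π` on histories induced by the policy `π`. The chain `M_π^s` is the same
chain started in `History.single s`. -/
noncomputable def MDP.induced (M : MDP S Act AP) (π : Policy Act) :
    MarkovChain (History S) AP where
  step h := (π h).bind fun a => (M.P h.last a).map h.snoc
  init := History.single M.init
  label h := M.label h.last

end MDP

/-! ### Continuing PCTL -/

/-- State formulas of continuing PCTL; `prob q Φ₁ Φ₂` is `P_{≥ q}[Φ₁ W (Φ₁ ∧ Φ₂)]`. -/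
inductive CPCTL (AP : Type*) where
  | atom (a : AP) : CPCTL AP
  | natom (a : AP) : CPCTL AP
  | and (Φ Ψ : CPCTL AP) : CPCTL AP
  | prob (q : unitInterval) (Φ₁ Φ₂ : CPCTL AP) : CPCTL AP

namespace CPCTL

variable {AP : Type*}

/-- Continuing PCTL as a fragment of PCTL. -/
def toPCTL : CPCTL AP → PCTLState AP
  | atom a => .atom a
  | natom a => .not (.atom a)
  | and Φ Ψ => .and Φ.toPCTL Ψ.toPCTL
  | prob q Φ₁ Φ₂ => .prob q (.weakUntil Φ₁.toPCTL (.and Φ₁.toPCTL Φ₂.toPCTL))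

open Classical in
/-- The literal projection. -/
noncomputable def alit : CPCTL AP → PCTLState AP
  | atom a => .atom a
  | natom a => .not (.atom a)
  | and Φ Ψ => .and Φ.alit Ψ.alit
  | prob q Φ₁ _ => if q = 0 then .top else Φ₁.alit

/-- `T(Φ, d)`: the threshold of each subformula `Ψ = P_{≥ q}[…]` of `Φ` is replaced by `d Ψ`. -/
def withThresholds (d : CPCTL AP → unitInterval) : CPCTL AP → CPCTL AP
  | atom a => atom a
  | natom a => natom a
  | and Φ Ψ => and (Φ.withThresholds d) (Ψ.withThresholds d)
  | prob q Φ₁ Φ₂ => prob (d (prob q Φ₁ Φ₂)) (Φ₁.withThresholds d) (Φ₂.withThresholds d)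

/-- The state subformulas of a formula. -/
def subformulas : CPCTL AP → Set (CPCTL AP)
  | atom a => {atom a}
  | natom a => {natom a}
  | and Φ Ψ => {and Φ Ψ} ∪ (Φ.subformulas ∪ Ψ.subformulas)
  | prob q Φ₁ Φ₂ => {prob q Φ₁ Φ₂, and Φ₁ Φ₂} ∪ (Φ₁.subformulas ∪ Φ₂.subformulas)

/-- The top-level conjuncts of a formula. -/
def conjuncts : CPCTL AP → Set (CPCTL AP)
  | atom a => {atom a}
  | natom a => {natom a}
  | and Φ Ψ => Φ.conjuncts ∪ Ψ.conjuncts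
  | prob q Φ₁ Φ₂ => {prob q Φ₁ Φ₂}

theorem self_mem_subformulas (Φ : CPCTL AP) : Φ ∈ Φ.subformulas := by
  cases Φ <;> simp [subformulas]

theorem left_mem_subformulas (q : unitInterval) (Φ₁ Φ₂ : CPCTL AP) :
    Φ₁ ∈ (prob q Φ₁ Φ₂).subformulas :=
  Or.inr (Or.inl Φ₁.self_mem_subformulas)

theorem right_mem_subformulas (q : unitInterval) (Φ₁ Φ₂ : CPCTL AP) :
    Φ₂ ∈ (prob q Φ₁ Φ₂).subformulas :=
  Or.inr (Or.inr Φ₂.self_mem_subformulas)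

theorem subformulas_trans {Φ Ψ χ : CPCTL AP} (h₁ : Φ ∈ Ψ.subformulas)
    (h₂ : Ψ ∈ χ.subformulas) : Φ ∈ χ.subformulas := by
  induction χ with
  | atom a => simp only [subformulas, Set.mem_singleton_iff] at h₂; subst h₂; exact h₁
  | natom a => simp only [subformulas, Set.mem_singleton_iff] at h₂; subst h₂; exact h₁
  | and A B ihA ihB =>
    rcases h₂ with h | h | h
    · rw [Set.mem_singleton_iff] at h; subst h; exact h₁
    · exact Or.inr (Or.inl (ihA h))
    · exact Or.inr (Or.inr (ihB h))
  | prob q A B ihA ihB =>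
    rcases h₂ with (h | h) | h | h
    · subst h; exact h₁
    · rw [Set.mem_singleton_iff] at h
      subst h
      rcases h₁ with h' | h'
      · exact Or.inl (Or.inr h')
      · exact Or.inr h'
    · exact Or.inr (Or.inl (ihA h))
    · exact Or.inr (Or.inr (ihB h))

end CPCTL

/-- `SF(Φ)`: the state subformulas of `Φ`, the indices of the valuations. -/
def SF {AP : Type*} (Φ : CPCTL AP) := {Ψ : CPCTL AP // Ψ ∈ Φ.subformulas}

/-- `PF(Φ)`: the path subformulas `φ_j = left W (left ∧ right)` of `Φ`, each with the threshold
`thr` under which it occurs; they are the indices of the counters. -/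
structure PF {AP : Type*} (Φ : CPCTL AP) where
  thr : unitInterval
  left : CPCTL AP
  right : CPCTL AP
  mem : CPCTL.prob thr left right ∈ Φ.subformulas

namespace PF

variable {AP : Type*} {Φ : CPCTL AP}

/-- The state formula `P_{≥ p_j}[φ_j]` that belongs to `φ_j`. -/
def formula (j : PF Φ) : CPCTL AP := .prob j.thr j.left j.right

/-- `P_{≥ p_j}[φ_j]` as a state subformula. -/
def stateSF (j : PF Φ) : SF Φ := ⟨j.formula, j.mem⟩

/-- The left operand `Φ_{j₁}` as a state subformula. -/
def leftSF (j : PF Φ) : SF Φ :=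
  ⟨j.left, CPCTL.subformulas_trans (CPCTL.left_mem_subformulas _ _ _) j.mem⟩

/-- The right operand `Φ_{j₂}` as a state subformula. -/
def rightSF (j : PF Φ) : SF Φ :=
  ⟨j.right, CPCTL.subformulas_trans (CPCTL.right_mem_subformulas _ _ _) j.mem⟩

end PF

/-! ### The generalized Slater assumption -/

/-- Some policy satisfies a formula that is obtained from `Φ` by strictly raising all its
probability thresholds, nested ones included. -/
def MDP.GeneralizedSlater {S AP : Type*} {Act : S → Type*} (M : MDP S Act AP)
    (Φ : CPCTL AP) : Prop :=
  ∃ d : CPCTL AP → unitInterval, (∀ j : PF Φ, j.thr < d j.formula) ∧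
    ∃ π : Policy Act, (M.induced π).Models (Φ.withThresholds d).toPCTL

/-! ### Value iteration -/

/-- Profiles `(μ, ν)`: valuations `μ ∈ {0,1}^{SF(Φ)}` and counters `ν ∈ [0,1]^{PF(Φ)}`, with the
componentwise order of the product. -/
abbrev Profile {AP : Type*} (Φ : CPCTL AP) := (SF Φ → Bool) × (PF Φ → unitInterval)

section VI

variable {S AP : Type*} {Act : S → Type*}

/-- State compatibility of valuations `μ` with counters `ν` at the state `s`. -/
def MDP.StateCompatible (M : MDP S Act AP) (Φ : CPCTL AP) (s : S)
    (ν : PF Φ → unitInterval) (μ : SF Φ → Bool) : Prop :=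
  (∀ j : PF Φ, μ j.stateSF = true → j.thr ≤ ν j) ∧
  (∀ i i₁ i₂ : SF Φ, i.1 = .and i₁.1 i₂.1 → μ i = true → μ i₁ = true ∧ μ i₂ = true) ∧
  (∀ (i : SF Φ) (a : AP), i.1 = .atom a → μ i = true → a ∈ M.label s) ∧
  (∀ (i : SF Φ) (a : AP), i.1 = .natom a → μ i = true → a ∉ M.label s)

open Classical in
/-- The initial value vector `I_M`: the counters are given by a policy `π` through
`ν_j = 1` if `M_π^s ⊨ P_{≥ 1}[G alit(Φ_j)]`, with `Φ_j = P_{≥ p_j}[φ_j]`, and `ν_j = 0` otherwise;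
the valuations are the maximal ones that are state compatible with these counters. -/
def MDP.initialValue (M : MDP S Act AP) (Φ : CPCTL AP) (s : S) : Set (Profile Φ) :=
  {x | (∃ π : Policy Act, ∀ j : PF Φ,
      x.2 j = if (M.induced π).Sat (.prob 1 (.globally j.formula.alit)) (History.single s)
        then 1 else 0) ∧
    Maximal (M.StateCompatible Φ s x.2) x.1}

variable [Fintype S] [∀ s, Fintype (Act s)]

/-- The conditions of the Bellman operator on a profile `x` at the state `s`, for the action
distribution `δ` and the profiles `y s'` at the states `s'`. -/
def MDP.BellmanCondition (M : MDP S Act AP) (Φ : CPCTL AP) (s : S) (δ : PMF (Act s))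
    (y : S → Profile Φ) (x : Profile Φ) : Prop :=
  (∀ (i : SF Φ) (a : AP), i.1 = .atom a → (x.1 i = true ↔ a ∈ M.label s)) ∧
  (∀ (i : SF Φ) (a : AP), i.1 = .natom a → (x.1 i = true ↔ a ∉ M.label s)) ∧
  (∀ i i₁ i₂ : SF Φ, i.1 = .and i₁.1 i₂.1 → x.1 i = (x.1 i₁ && x.1 i₂)) ∧
  (∀ j : PF Φ, x.1 j.stateSF = true ↔ j.thr ≤ x.2 j) ∧
  (∀ j : PF Φ, (x.2 j : ℝ) =
    if x.1 j.leftSF = false then 0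
    else if x.1 j.rightSF = true then 1
    else ∑ a : Act s, ∑ s' : S, (δ a).toReal * (M.P s a s').toReal * ((y s').2 j : ℝ))

/-- The extended Bellman operator: the maximal elements of the set of all profiles that satisfy
the Bellman conditions for some action distribution and some profiles taken from `V`. -/
def MDP.bellman (M : MDP S Act AP) (Φ : CPCTL AP) (V : S → Set (Profile Φ)) (s : S) :
    Set (Profile Φ) :=
  {x | Maximal (fun x => ∃ (δ : PMF (Act s)) (y : S → Profile Φ),
    (∀ s', y s' ∈ V s') ∧ M.BellmanCondition Φ s δ y x) x}

/-- The value frontier after `n` steps of CPCTL-VI. -/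
def MDP.valueFrontier (M : MDP S Act AP) (Φ : CPCTL AP) (n : ℕ) : S → Set (Profile Φ) :=
  (M.bellman Φ)^[n] (M.initialValue Φ)

end VI

-- Paths of Markov chains: finite-horizon bounds and closed sets

section Chain

open MeasureTheory ProbabilityTheory ENNReal

-- Run the Slater policy `π` for `r` steps and evaluate `Φ`, with its original thresholds, backwards
-- from the horizon, where the counters are those of the initial vector. This truncated semantics
-- (`truncCounter`, `TruncSat`) obeys the Bellman conditions with `δ = π h`. Since the largest
-- solution of these conditions is monotone in the successor profiles, the truncated profile at `h`
-- lies below some element of `V_r` at the last state of `h` (`exists_mem_valueFrontier_ge`). It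
-- remains to show that `Φ` holds at `s₀` in the truncated semantics for large `r`
-- (`eventually_truncSat`).
--
-- The proof is by induction on the formula. For `P_{≥ q}[A W (A ∧ B)]`, let `TA` and `TB` be the
-- sets of histories where `A` and `B` hold with raised thresholds. Runs that reach `TA ∩ TB` or
-- leave `TA` within `t` steps are settled: there are finitely many histories of that length, so by
-- induction the truncated semantics recognises `A` and `B` on the relevant ones once `r` is large.
-- The danger lies in runs still in `TA \ TB` at time `t`: their counters depend on the horizon.
-- They satisfy, uniformly in `r`, the bound `1 - C * (1 - g)`, where `g` is the probability of
-- staying in `TA \ TB` forever. The total loss is therefore at most `C` times the probability of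
-- being in `TA \ TB` up to time `t` but not forever. This tends to `0`, hence drops below the
-- Slater slack `d - q`.
--
-- The uniform bound (`le_truncCounter`, `truncSat_of_safeInf`) comes from the initial vector. In a
-- finite MDP, if a set of states is kept invariant with probability close enough to `1`, then some
-- policy keeps it invariant almost surely. By a union bound one policy serves all the relevant
-- literal projections at once (`exists_joint_policy`), so the corresponding horizon counters are
-- `1` simultaneously.
--
-- Finally, the Bellman operator keeps only maximal profiles, so each solution must lie below a
-- maximal one. The solution set need not be closed, but its closure is dominated by it; this
-- property survives the iteration and suffices for Zorn's lemma.

theorem PMF.toMeasure_bind_map_eq_sum {α β γ : Type*} [Fintype α] [Fintype β]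
    [MeasurableSpace γ] [DiscreteMeasurableSpace γ] (p : PMF α) (k : α → PMF β) (f : β → γ) :
    (p.bind fun a => (k a).map f).toMeasure =
      ∑ a, p a • ∑ b, k a b • Measure.dirac (f b) := by
  classical
  ext s hs
  let _ : MeasurableSpace β := ⊤
  rw [PMF.toMeasure_bind_apply _ _ _ hs, tsum_fintype]
  simp only [Measure.coe_finsetSum, Finset.sum_apply, Measure.smul_apply, smul_eq_mul]
  refine Finset.sum_congr rfl fun a _ => ?_
  rw [PMF.toMeasure_map_apply f (k a) s measurable_from_top hs,
    PMF.toMeasure_apply_fintype]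
  simp [Measure.dirac_apply' _ hs, Set.indicator]

theorem PMF.lintegral_bind_map {α β γ : Type*} [Fintype α] [Fintype β]
    [MeasurableSpace γ] [DiscreteMeasurableSpace γ] (p : PMF α) (k : α → PMF β) (f : β → γ)
    (g : γ → ℝ≥0∞) :
    ∫⁻ x, g x ∂(p.bind fun a => (k a).map f).toMeasure = ∑ a, ∑ b, p a * k a b * g (f b) := by
  rw [PMF.toMeasure_bind_map_eq_sum]
  simp [lintegral_smul_measure,
    lintegral_dirac' _ (Measurable.of_discrete (f := g)), Finset.mul_sum, mul_assoc]

namespace MarkovChain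

variable {Q AP : Type*} [MeasurableSpace Q] [DiscreteMeasurableSpace Q]

open Classical in
/-- The probability that `A W (A ∧ B)` is not violated within `k` steps. -/
noncomputable def weakUntilBound (C : MarkovChain Q AP) (A B : Set Q) : ℕ → Q → ℝ≥0∞
  | 0, _ => 1
  | k + 1, q => if q ∉ A then 0 else if q ∈ B then 1 else
      ∫⁻ q', C.weakUntilBound A B k q' ∂(C.step q).toMeasure

/-- The paths that satisfy `A W (A ∧ B)` from the position `n` on. -/
def weakUntilFrom (A B : Set Q) (n : ℕ) : Set (ℕ → Q) :=
  {ξ | (∃ j ≥ n, ξ j ∈ A ∩ B ∧ ∀ i ≥ n, i ≤ j → ξ i ∈ A) ∨ ∀ j ≥ n, ξ j ∈ A}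

theorem measurableSet_weakUntilFrom (A B : Set Q) (n : ℕ) :
    MeasurableSet (weakUntilFrom A B n) := by
  have h : ∀ (D : Set Q) (i : ℕ), MeasurableSet {ξ : ℕ → Q | ξ i ∈ D} := fun D i =>
    measurable_pi_apply i (MeasurableSet.of_discrete (s := D))
  have : weakUntilFrom A B n =
      (⋃ j, ⋃ (_ : j ≥ n), ({ξ : ℕ → Q | ξ j ∈ A ∩ B} ∩
        ⋂ i, ⋂ (_ : i ≥ n), ⋂ (_ : i ≤ j), {ξ : ℕ → Q | ξ i ∈ A})) ∪
      ⋂ j, ⋂ (_ : j ≥ n), {ξ : ℕ → Q | ξ j ∈ A} := by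
    ext ξ
    simp only [weakUntilFrom, Set.mem_ofPred_eq, Set.mem_union, Set.mem_iUnion, Set.mem_inter_iff,
      Set.mem_iInter, exists_prop]
  rw [this]
  refine MeasurableSet.union ?_ ?_
  · refine MeasurableSet.iUnion fun j => MeasurableSet.iUnion fun _ => (h _ _).inter ?_
    exact MeasurableSet.iInter fun i => MeasurableSet.iInter fun _ =>
      MeasurableSet.iInter fun _ => h _ _
  · exact MeasurableSet.iInter fun i => MeasurableSet.iInter fun _ => h _ _

theorem traj_apply_eq_lintegral (C : MarkovChain Q AP) (n : ℕ)
    (x : (i : Finset.Iic n) → (fun _ : ℕ => Q) i) {D : Set (ℕ → Q)} (hD : MeasurableSet D) :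
    Kernel.traj (X := fun _ => Q) C.kernel n x D =
      ∫⁻ y, Kernel.traj (X := fun _ => Q) C.kernel (n + 1) y D
        ∂(Kernel.partialTraj (X := fun _ => Q) C.kernel n (n + 1) x) := by
  have h := Kernel.traj_comp_partialTraj (X := fun _ => Q) (κ := C.kernel) n.le_succ
  rw [← Kernel.comp_apply' _ _ _ hD, h]

theorem lintegral_partialTraj_succ (C : MarkovChain Q AP) (n : ℕ)
    (x : (i : Finset.Iic n) → (fun _ : ℕ => Q) i) (f : Q → ℝ≥0∞) :
    ∫⁻ y, f (y ⟨n + 1, Finset.mem_Iic.2 le_rfl⟩)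
        ∂(Kernel.partialTraj (X := fun _ => Q) C.kernel n (n + 1) x) =
      ∫⁻ q, f q ∂(C.step (x ⟨n, Finset.mem_Iic.2 le_rfl⟩)).toMeasure := by
  have h := Kernel.map_partialTraj_succ_self (X := fun _ => Q) (κ := C.kernel) n
  have h' : (C.step (x ⟨n, Finset.mem_Iic.2 le_rfl⟩)).toMeasure =
      (Kernel.partialTraj (X := fun _ => Q) C.kernel n (n + 1) x).map
        (fun x => x ⟨n + 1, Finset.mem_Iic.2 le_rfl⟩) := by
    rw [← Kernel.map_apply _ (measurable_pi_apply _), h]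
    rfl
  rw [h', lintegral_map (Measurable.of_discrete) (measurable_pi_apply _)]

theorem traj_ae_eq (C : MarkovChain Q AP) (n : ℕ)
    (x : (i : Finset.Iic n) → (fun _ : ℕ => Q) i) :
    ∀ᵐ ξ ∂(Kernel.traj (X := fun _ => Q) C.kernel n x),
      ξ n = x ⟨n, Finset.mem_Iic.2 le_rfl⟩ := by
  have h := Kernel.traj_map_frestrictLe_apply (X := fun _ => Q) (κ := C.kernel) n n x
  rw [Kernel.partialTraj_self, Kernel.id_apply] at h
  have h2 : (Kernel.traj (X := fun _ => Q) C.kernel n x).map (fun ξ => ξ n) =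
      Measure.dirac (x ⟨n, Finset.mem_Iic.2 le_rfl⟩) := by
    have : (fun ξ : (i : ℕ) → Q => ξ n) =
        (fun y : (i : Finset.Iic n) → Q => y ⟨n, Finset.mem_Iic.2 le_rfl⟩) ∘
          Preorder.frestrictLe (π := fun _ => Q) n := rfl
    rw [this, ← Measure.map_map (measurable_pi_apply _) (by fun_prop), h,
      Measure.map_dirac' (measurable_pi_apply _)]
  have h3 : ∀ᵐ q ∂(Kernel.traj (X := fun _ => Q) C.kernel n x).map (fun ξ => ξ n),
      q = x ⟨n, Finset.mem_Iic.2 le_rfl⟩ := by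
    rw [h2]
    exact (ae_dirac_iff (MeasurableSet.of_discrete
      (s := {q | q = x ⟨n, Finset.mem_Iic.2 le_rfl⟩}))).2 rfl
  exact ae_of_ae_map (measurable_pi_apply n).aemeasurable h3

/-- Conditioning on one step: outside `A` the path formula is already violated, on `A ∩ B` the bound
is trivial, and otherwise the obligation passes to position `n + 1`. The past `x` of arbitrary
length is quantified inside the induction because this step lengthens it. -/
theorem traj_weakUntilFrom_le (C : MarkovChain Q AP) (A B : Set Q) (k : ℕ) :
    ∀ (n : ℕ) (x : (i : Finset.Iic n) → (fun _ : ℕ => Q) i),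
      Kernel.traj (X := fun _ => Q) C.kernel n x (weakUntilFrom A B n) ≤
        C.weakUntilBound A B k (x ⟨n, Finset.mem_Iic.2 le_rfl⟩) := by
  induction k with
  | zero => exact fun n x => prob_le_one
  | succ k ih =>
    intro n x
    rw [weakUntilBound]
    by_cases hA : x ⟨n, Finset.mem_Iic.2 le_rfl⟩ ∈ A
    swap
    · rw [if_pos hA, nonpos_iff_eq_zero]
      refine measure_eq_zero_iff_ae_notMem.2 ?_
      filter_upwards [C.traj_ae_eq n x] with ξ hξ
      rintro (⟨j, hj, -, h⟩ | h)
      · exact hA (hξ ▸ h n le_rfl hj)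
      · exact hA (hξ ▸ h n le_rfl)
    rw [if_neg (not_not.2 hA)]
    by_cases hB : x ⟨n, Finset.mem_Iic.2 le_rfl⟩ ∈ B
    · rw [if_pos hB]
      exact prob_le_one
    · rw [if_neg hB]
      -- Position `n` is almost surely outside `B`, so a witness of `A ∧ B` must come later.
      calc Kernel.traj (X := fun _ => Q) C.kernel n x (weakUntilFrom A B n)
          ≤ Kernel.traj (X := fun _ => Q) C.kernel n x (weakUntilFrom A B (n + 1)) := by
            refine measure_mono_ae ?_
            filter_upwards [C.traj_ae_eq n x] with ξ hξ
            rintro (⟨j, hj, h1, h⟩ | h)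
            · refine Or.inl ⟨j, ?_, h1, fun i hi hij => h i (by omega) hij⟩
              rcases hj.lt_or_eq with h2 | h2
              · exact h2
              · subst h2
                exact absurd (hξ ▸ h1.2) hB
            · exact Or.inr fun j hj => h j (by omega)
        _ = _ := C.traj_apply_eq_lintegral n x (measurableSet_weakUntilFrom A B (n + 1))
        _ ≤ _ := lintegral_mono fun y => ih (n + 1) y
        _ = _ := C.lintegral_partialTraj_succ n x (C.weakUntilBound A B k)

theorem pathMeasure_weakUntil_le (C : MarkovChain Q AP) (A B : Set Q) (k : ℕ) (q : Q) :
    C.pathMeasure q {ξ | (∃ j, ξ j ∈ A ∩ B ∧ ∀ i ≤ j, ξ i ∈ A) ∨ ∀ j, ξ j ∈ A} ≤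
      C.weakUntilBound A B k q := by
  have := C.traj_weakUntilFrom_le A B k 0 (fun _ => q)
  simp only [weakUntilFrom, ge_iff_le, zero_le, true_and, forall_const] at this
  exact this

theorem traj_ae_mem (C : MarkovChain Q AP) {W : Set Q}
    (hW : ∀ q ∈ W, ∀ᵐ q' ∂(C.step q).toMeasure, q' ∈ W) (k : ℕ) :
    ∀ (n : ℕ) (x : (i : Finset.Iic n) → (fun _ : ℕ => Q) i),
      x ⟨n, Finset.mem_Iic.2 le_rfl⟩ ∈ W →
      ∀ᵐ ξ ∂(Kernel.traj (X := fun _ => Q) C.kernel n x), ξ (n + k) ∈ W := by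
  induction k with
  | zero =>
    intro n x hx
    filter_upwards [C.traj_ae_eq n x] with ξ hξ
    rw [add_zero, hξ]
    exact hx
  | succ k ih =>
    intro n x hx
    have hm : MeasurableSet {ξ : ℕ → Q | ξ (n + (k + 1)) ∉ W} :=
      measurable_pi_apply (X := fun _ => Q) (n + (k + 1))
        (MeasurableSet.of_discrete (s := Wᶜ))
    rw [ae_iff, C.traj_apply_eq_lintegral n x hm, lintegral_eq_zero_iff (Kernel.measurable_coe _ hm)]
    have h1 : ∀ᵐ y ∂(Kernel.partialTraj (X := fun _ => Q) C.kernel n (n + 1) x),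
        y ⟨n + 1, Finset.mem_Iic.2 le_rfl⟩ ∈ W := by
      -- Integrating the indicator of the complement transfers the almost sure statement from the
      -- step distribution to the one-step extension of the past.
      have h2 := C.lintegral_partialTraj_succ n x (Wᶜ.indicator 1)
      have h3 : ∫⁻ q, Wᶜ.indicator 1 q ∂(C.step (x ⟨n, Finset.mem_Iic.2 le_rfl⟩)).toMeasure = 0 := by
        rw [lintegral_indicator_one MeasurableSet.of_discrete]
        exact ae_iff.1 (hW _ hx)
      rw [h3] at h2
      have h4 := (lintegral_eq_zero_iff ((Measurable.of_discrete (f := Wᶜ.indicator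
        (1 : Q → ℝ≥0∞))).comp (measurable_pi_apply (X := fun _ => Q)
          (⟨n + 1, Finset.mem_Iic.2 le_rfl⟩ : Finset.Iic (n + 1))))).1 h2
      filter_upwards [h4] with y hy
      by_contra hc
      simp [hc] at hy
    filter_upwards [h1] with y hy
    have := ae_iff.1 (ih (n + 1) y hy)
    rw [show n + 1 + k = n + (k + 1) by omega] at this
    exact this

theorem pathMeasure_forall_mem (C : MarkovChain Q AP) {W : Set Q}
    (hW : ∀ q ∈ W, ∀ᵐ q' ∂(C.step q).toMeasure, q' ∈ W) {q : Q} (hq : q ∈ W) :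
    ∀ᵐ ξ ∂(C.pathMeasure q), ∀ j, ξ j ∈ W := by
  refine ae_all_iff.2 fun j => ?_
  have := C.traj_ae_mem hW j 0 (fun _ => q) hq
  rwa [zero_add] at this

instance (C : MarkovChain Q AP) (q : Q) : IsProbabilityMeasure (C.pathMeasure q) :=
  inferInstanceAs (IsProbabilityMeasure
    (Kernel.traj (X := fun _ => Q) C.kernel 0 (fun _ => q)))

end MarkovChain

end Chain

-- One-step expectations and finite-horizon probabilities under a policy

section Value

open Filter Topology

variable {S AP : Type*} {Act : S → Type*}

namespace MDP

/-- The states in which the literal projection of a formula holds. -/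
def LitSat (M : MDP S Act AP) (s : S) : CPCTL AP → Prop
  | .atom a => a ∈ M.label s
  | .natom a => a ∉ M.label s
  | .and Φ Ψ => M.LitSat s Φ ∧ M.LitSat s Ψ
  | .prob q Φ₁ _ => q = 0 ∨ M.LitSat s Φ₁

theorem sat_alit (M : MDP S Act AP) (π : Policy Act) (Φ : CPCTL AP) (h : History S) :
    (M.induced π).Sat Φ.alit h ↔ M.LitSat h.last Φ := by
  induction Φ with
  | atom a => simp [CPCTL.alit, MarkovChain.Sat, LitSat, induced]
  | natom a => simp [CPCTL.alit, MarkovChain.Sat, LitSat, induced]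
  | and A B ihA ihB => simp [CPCTL.alit, MarkovChain.Sat, LitSat, ihA, ihB]
  | prob q A B ihA ihB =>
    by_cases hq : q = 0
    · simp [CPCTL.alit, MarkovChain.Sat, LitSat, hq]
    · simp [CPCTL.alit, LitSat, hq, ihA]

/-- The histories in whose last state the literal projection of `Ψ` holds. -/
def litSet (M : MDP S Act AP) (Ψ : CPCTL AP) : Set (History S) := {h | M.LitSat h.last Ψ}

theorem litSet_prob (M : MDP S Act AP) {q : unitInterval} (hq : q ≠ 0) (A B : CPCTL AP) :
    M.litSet (.prob q A B) = M.litSet A := by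
  ext h
  simp [litSet, LitSat, hq]

variable [Fintype S] [∀ s, Fintype (Act s)]

/-- The expected value after one step of a function on histories. -/
noncomputable def expect (M : MDP S Act AP) (π : Policy Act) (f : History S → ℝ)
    (h : History S) : ℝ :=
  ∑ a, ∑ s, (π h a).toReal * (M.P h.last a s).toReal * f (h.snoc s)

theorem _root_.PMF.sum_toReal {α : Type*} [Fintype α] (p : PMF α) : ∑ a, (p a).toReal = 1 := by
  rw [← ENNReal.toReal_sum fun a _ => p.apply_ne_top a, ← tsum_fintype (L := .unconditional α),
    p.tsum_coe, ENNReal.toReal_one]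

theorem sum_weights (M : MDP S Act AP) (s : S) (δ : PMF (Act s)) :
    ∑ a, ∑ s', (δ a).toReal * (M.P s a s').toReal = 1 := by
  simp_rw [← Finset.mul_sum, PMF.sum_toReal, mul_one, PMF.sum_toReal]

variable (M : MDP S Act AP) (π : Policy Act)

theorem expect_mono {f g : History S → ℝ} {h : History S}
    (hfg : ∀ s, f (h.snoc s) ≤ g (h.snoc s)) : M.expect π f h ≤ M.expect π g h :=
  Finset.sum_le_sum fun _ _ => Finset.sum_le_sum fun s _ =>
    mul_le_mul_of_nonneg_left (hfg s) (by positivity)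

theorem expect_const (c : ℝ) (h : History S) : M.expect π (fun _ => c) h = c := by
  simp_rw [expect, ← Finset.sum_mul, M.sum_weights h.last (π h), one_mul]

theorem expect_add (f g : History S → ℝ) (h : History S) :
    M.expect π (fun h => f h + g h) h = M.expect π f h + M.expect π g h := by
  simp only [expect, mul_add, Finset.sum_add_distrib]

theorem expect_sub (f g : History S → ℝ) (h : History S) :
    M.expect π (fun h => f h - g h) h = M.expect π f h - M.expect π g h := by
  simp only [expect, mul_sub, Finset.sum_sub_distrib]

theorem expect_const_mul (c : ℝ) (f : History S → ℝ) (h : History S) :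
    M.expect π (fun h => c * f h) h = c * M.expect π f h := by
  simp only [expect, Finset.mul_sum]
  refine Finset.sum_congr rfl fun _ _ => Finset.sum_congr rfl fun _ _ => by ring

theorem expect_nonneg {f : History S → ℝ} (hf : ∀ h, 0 ≤ f h) (h : History S) :
    0 ≤ M.expect π f h :=
  (M.expect_const π 0 h).symm.trans_le (M.expect_mono π fun _ => hf _)

theorem expect_le_one {f : History S → ℝ} (hf : ∀ h, f h ≤ 1) (h : History S) :
    M.expect π f h ≤ 1 :=
  (M.expect_mono π fun _ => hf _).trans_eq (M.expect_const π 1 h)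

open Classical in
/-- The probability that the chain stays in `D` for the next `k` positions. -/
noncomputable def safe (D : Set (History S)) : ℕ → History S → ℝ
  | 0, _ => 1
  | k + 1, h => if h ∈ D then M.expect π (safe D k) h else 0

/-- The probability that the chain stays in `D` forever. -/
noncomputable def safeInf (D : Set (History S)) (h : History S) : ℝ :=
  ⨅ k, M.safe π D k h

variable (D : Set (History S))

theorem safe_nonneg (k : ℕ) (h : History S) : 0 ≤ M.safe π D k h := by
  induction k generalizing h with
  | zero => exact zero_le_one
  | succ k ih =>
    rw [safe]
    split_ifs
    exacts [M.expect_nonneg π ih h, le_rfl]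

theorem safe_le_one (k : ℕ) (h : History S) : M.safe π D k h ≤ 1 := by
  induction k generalizing h with
  | zero => exact le_rfl
  | succ k ih =>
    rw [safe]
    split_ifs
    exacts [M.expect_le_one π ih h, zero_le_one]

theorem safe_antitone (h : History S) : Antitone fun k => M.safe π D k h := by
  refine antitone_nat_of_succ_le fun k => ?_
  induction k generalizing h with
  | zero => exact M.safe_le_one π D _ h
  | succ k ih =>
    rw [safe, safe]
    split_ifs
    exacts [M.expect_mono π fun s => ih _, le_rfl]

theorem safe_mono {D E : Set (History S)} (hDE : D ⊆ E) (k : ℕ) (h : History S) :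
    M.safe π D k h ≤ M.safe π E k h := by
  induction k generalizing h with
  | zero => exact le_rfl
  | succ k ih =>
    rw [safe, safe]
    split_ifs with h1 h2
    exacts [M.expect_mono π fun s => ih _, absurd (hDE h1) h2, M.expect_nonneg π
      (M.safe_nonneg π E k) h, le_rfl]

theorem bddBelow_safe (h : History S) : BddBelow (Set.range fun k => M.safe π D k h) :=
  ⟨0, by rintro _ ⟨k, rfl⟩; exact M.safe_nonneg π D k h⟩

theorem safeInf_le_safe (k : ℕ) (h : History S) : M.safeInf π D h ≤ M.safe π D k h :=
  ciInf_le (M.bddBelow_safe π D h) k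

theorem safeInf_nonneg (h : History S) : 0 ≤ M.safeInf π D h :=
  le_ciInf fun k => M.safe_nonneg π D k h

theorem safeInf_le_one (h : History S) : M.safeInf π D h ≤ 1 :=
  M.safeInf_le_safe π D 0 h

theorem tendsto_safe (h : History S) :
    Tendsto (fun k => M.safe π D k h) atTop (𝓝 (M.safeInf π D h)) :=
  tendsto_atTop_ciInf (M.safe_antitone π D h) (M.bddBelow_safe π D h)

theorem safeInf_mono {D E : Set (History S)} (hDE : D ⊆ E) (h : History S) :
    M.safeInf π D h ≤ M.safeInf π E h :=
  le_ciInf fun k => (M.safeInf_le_safe π D k h).trans (M.safe_mono π hDE k h)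

/-- The limit of the finite-horizon recursion, taken inside finite sums. This submartingale
inequality takes the place of a zero-one law in the later inductions. -/
theorem safeInf_le_expect (h : History S) :
    M.safeInf π D h ≤ M.expect π (M.safeInf π D) h := by
  have h1 : Tendsto (fun k => M.expect π (M.safe π D k) h) atTop
      (𝓝 (M.expect π (M.safeInf π D) h)) :=
    tendsto_finsetSum _ fun a _ => tendsto_finsetSum _ fun s _ =>
      (M.tendsto_safe π D (h.snoc s)).const_mul _
  refine ge_of_tendsto h1 (Eventually.of_forall fun k => ?_)
  refine (M.safeInf_le_safe π D (k + 1) h).trans ?_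
  rw [safe]
  split_ifs
  exacts [le_rfl, M.expect_nonneg π (M.safe_nonneg π D k) h]

theorem safeInf_eq_zero {h : History S} (hD : h ∉ D) : M.safeInf π D h = 0 := by
  refine le_antisymm ((M.safeInf_le_safe π D 1 h).trans_eq ?_) (M.safeInf_nonneg π D h)
  rw [safe, if_neg hD]

open Classical in
/-- The probability that `A W (A ∧ B)` is not violated in the next `k` positions. -/
noncomputable def weakUntilValue (A B : Set (History S)) : ℕ → History S → ℝ
  | 0, _ => 1
  | k + 1, h => if h ∉ A then 0 else if h ∈ B then 1 else
      M.expect π (weakUntilValue A B k) h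

theorem weakUntilValue_nonneg (A B : Set (History S)) (k : ℕ) (h : History S) :
    0 ≤ M.weakUntilValue π A B k h := by
  induction k generalizing h with
  | zero => exact zero_le_one
  | succ k ih =>
    rw [weakUntilValue]
    split_ifs
    exacts [zero_le_one, M.expect_nonneg π ih h, le_rfl]

theorem lintegral_step (f : History S → ℝ) (hf : ∀ h, 0 ≤ f h) (h : History S) :
    ∫⁻ h', ENNReal.ofReal (f h') ∂((M.induced π).step h).toMeasure =
      ENNReal.ofReal (M.expect π f h) := by
  rw [induced, PMF.lintegral_bind_map, expect, ENNReal.ofReal_sum_of_nonneg fun a _ =>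
    Finset.sum_nonneg fun s _ => mul_nonneg (by positivity) (hf _)]
  refine Finset.sum_congr rfl fun a _ => ?_
  rw [ENNReal.ofReal_sum_of_nonneg fun s _ => mul_nonneg (by positivity) (hf _)]
  refine Finset.sum_congr rfl fun s _ => ?_
  rw [ENNReal.ofReal_mul (by positivity), ENNReal.ofReal_mul ENNReal.toReal_nonneg,
    ENNReal.ofReal_toReal (PMF.apply_ne_top _ _), ENNReal.ofReal_toReal (PMF.apply_ne_top _ _)]

theorem weakUntilBound_induced (A B : Set (History S)) (k : ℕ) (h : History S) :
    (M.induced π).weakUntilBound A B k h = ENNReal.ofReal (M.weakUntilValue π A B k h) := by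
  induction k generalizing h with
  | zero => simp [MarkovChain.weakUntilBound, weakUntilValue]
  | succ k ih =>
    rw [MarkovChain.weakUntilBound, weakUntilValue]
    split_ifs
    · simp
    · simp_rw [ih]
      exact M.lintegral_step π _ (M.weakUntilValue_nonneg π A B k) h
    · simp

/-- A weak until that holds is not violated at any finite horizon. The probability operators
satisfied by the Slater policy enter the rest of the proof only through this bound. -/
theorem le_weakUntilValue_of_sat {q : unitInterval} {Φ Ψ : PCTLState AP} {h : History S}
    (hs : (M.induced π).Sat (.prob q (.weakUntil Φ (.and Φ Ψ))) h) (k : ℕ) :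
    (q : ℝ) ≤ M.weakUntilValue π {h | (M.induced π).Sat Φ h} {h | (M.induced π).Sat Ψ h} k h := by
  rw [MarkovChain.Sat] at hs
  refine hs.trans (ENNReal.toReal_le_of_le_ofReal (M.weakUntilValue_nonneg π _ _ k h) ?_)
  rw [← weakUntilBound_induced]
  refine le_trans (le_of_eq ?_) ((M.induced π).pathMeasure_weakUntil_le _ _ k h)
  congr 1

end MDP

end Value

-- Truncated semantics and why it eventually satisfies the formula

section Truncation

open Filter Topology

variable {S AP : Type*} {Act : S → Type*}

theorem CPCTL.and_left_mem_subformulas (A B : CPCTL AP) : A ∈ (CPCTL.and A B).subformulas :=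
  Or.inr (Or.inl A.self_mem_subformulas)

theorem CPCTL.and_right_mem_subformulas (A B : CPCTL AP) : B ∈ (CPCTL.and A B).subformulas :=
  Or.inr (Or.inr B.self_mem_subformulas)

namespace MDP

open Classical in
/-- Satisfaction at the state `s`, when `e` gives the expected counters at the successors. -/
noncomputable def Holds (M : MDP S Act AP) (s : S) (e : CPCTL AP → ℝ) : CPCTL AP → Prop
  | .atom a => a ∈ M.label s
  | .natom a => a ∉ M.label s
  | .and Φ Ψ => M.Holds s e Φ ∧ M.Holds s e Ψ
  | .prob q Φ Ψ => (q : ℝ) ≤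
      if M.Holds s e Φ then if M.Holds s e Ψ then 1 else e (.prob q Φ Ψ) else 0

open Classical in
/-- The counters at the state `s`, when `e` gives the expected counters at the successors. -/
noncomputable def counter (M : MDP S Act AP) (s : S) (e : CPCTL AP → ℝ) : CPCTL AP → ℝ
  | .prob q Φ Ψ => if M.Holds s e Φ then if M.Holds s e Ψ then 1 else e (.prob q Φ Ψ) else 0
  | _ => 0

/-- Satisfaction at the state `s`, when `ν` gives the counters at `s`. -/
def HoldsWith (M : MDP S Act AP) (s : S) (ν : CPCTL AP → ℝ) : CPCTL AP → Prop
  | .atom a => a ∈ M.label s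
  | .natom a => a ∉ M.label s
  | .and Φ Ψ => M.HoldsWith s ν Φ ∧ M.HoldsWith s ν Ψ
  | .prob q Φ Ψ => (q : ℝ) ≤ ν (.prob q Φ Ψ)

theorem counter_mem_Icc (M : MDP S Act AP) (s : S) {e : CPCTL AP → ℝ}
    (he : ∀ Ψ, e Ψ ∈ Set.Icc 0 1) (Ψ : CPCTL AP) : M.counter s e Ψ ∈ Set.Icc 0 1 := by
  cases Ψ <;> simp only [counter] <;> (try split_ifs) <;> first | exact he _ | simp

variable [Fintype S] [∀ s, Fintype (Act s)] (M : MDP S Act AP) (π : Policy Act)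
  (leaf : History S → CPCTL AP → ℝ)

/-- The counters with `r` steps to go, when `leaf` gives the counters at the horizon. -/
noncomputable def truncCounter : ℕ → History S → CPCTL AP → ℝ
  | 0, h => leaf h
  | r + 1, h => M.counter h.last fun Ψ => M.expect π (fun h' => truncCounter r h' Ψ) h

/-- Satisfaction with `r` steps to go, when `leaf` gives the counters at the horizon. -/
noncomputable def TruncSat : ℕ → History S → CPCTL AP → Prop
  | 0, h => M.HoldsWith h.last (leaf h)
  | r + 1, h => M.Holds h.last fun Ψ => M.expect π (fun h' => M.truncCounter π leaf r h' Ψ) h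

variable {leaf}

theorem truncSat_atom (r : ℕ) (h : History S) (a : AP) :
    M.TruncSat π leaf r h (.atom a) ↔ a ∈ M.label h.last := by
  cases r <;> rfl

theorem truncSat_natom (r : ℕ) (h : History S) (a : AP) :
    M.TruncSat π leaf r h (.natom a) ↔ a ∉ M.label h.last := by
  cases r <;> rfl

theorem truncSat_and (r : ℕ) (h : History S) (A B : CPCTL AP) :
    M.TruncSat π leaf r h (.and A B) ↔ M.TruncSat π leaf r h A ∧ M.TruncSat π leaf r h B := by
  cases r <;> rfl

theorem truncSat_prob (r : ℕ) (h : History S) (q : unitInterval) (A B : CPCTL AP) :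
    M.TruncSat π leaf r h (.prob q A B) ↔ (q : ℝ) ≤ M.truncCounter π leaf r h (.prob q A B) := by
  cases r <;> rfl

open Classical in
theorem truncCounter_succ (r : ℕ) (h : History S) (q : unitInterval) (A B : CPCTL AP) :
    M.truncCounter π leaf (r + 1) h (.prob q A B) =
      if M.TruncSat π leaf (r + 1) h A then if M.TruncSat π leaf (r + 1) h B then 1
        else M.expect π (fun h' => M.truncCounter π leaf r h' (.prob q A B)) h else 0 := rfl

theorem expect_mem_Icc {f : History S → ℝ} (hf : ∀ h, f h ∈ Set.Icc 0 1) (h : History S) :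
    M.expect π f h ∈ Set.Icc 0 1 :=
  ⟨M.expect_nonneg π (fun h => (hf h).1) h, M.expect_le_one π (fun h => (hf h).2) h⟩

theorem truncCounter_mem_Icc (hl : ∀ h Ψ, leaf h Ψ ∈ Set.Icc 0 1) (r : ℕ) (h : History S)
    (Ψ : CPCTL AP) : M.truncCounter π leaf r h Ψ ∈ Set.Icc 0 1 := by
  induction r generalizing h Ψ with
  | zero => exact hl h Ψ
  | succ r ih => exact M.counter_mem_Icc _ (fun Ψ => M.expect_mem_Icc π (fun h' => ih h' Ψ) h) Ψ

/-- The linear bound propagates backwards because invariance probabilities form a submartingale, so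
`C` does not depend on the distance to the horizon. Where invariance is not nearly certain the bound
is nonpositive and says nothing; elsewhere the leaf is `1`, or `A` holds and the counter does not
drop to `0`. -/
theorem le_truncCounter (hl : ∀ h Ψ, leaf h Ψ ∈ Set.Icc 0 1) {q : unitInterval} {A B : CPCTL AP}
    {ε₁ ε₂ : ℝ} (hε₁ : 0 < ε₁) (hε₂ : 0 < ε₂)
    (h_leaf : ∀ h, 1 - ε₁ < M.safeInf π (M.litSet A) h → leaf h (.prob q A B) = 1)
    (hA : ∀ r h, 1 - ε₂ < M.safeInf π (M.litSet A) h → M.TruncSat π leaf r h A) :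
    ∃ C : ℝ, 0 < C ∧ ∀ r h, 1 - C * (1 - M.safeInf π (M.litSet A) h) ≤
      M.truncCounter π leaf r h (.prob q A B) := by
  have hmem := M.truncCounter_mem_Icc π hl
  set g := M.safeInf π (M.litSet A) with hg
  have key : ∀ ε > 0, ε₁⁻¹ + ε₂⁻¹ ≥ ε⁻¹ → ∀ h, g h ≤ 1 - ε →
      1 - (ε₁⁻¹ + ε₂⁻¹) * (1 - g h) ≤ 0 := by
    intro ε hε hC h h1
    have h2 : ε⁻¹ * ε ≤ (ε₁⁻¹ + ε₂⁻¹) * (1 - g h) :=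
      mul_le_mul hC (by linarith) hε.le (by positivity)
    rw [inv_mul_cancel₀ hε.ne'] at h2
    linarith
  have key₁ := key ε₁ hε₁ (le_add_of_nonneg_right (by positivity))
  have key₂ := key ε₂ hε₂ (le_add_of_nonneg_left (by positivity))
  -- Any `C` that dominates both `1/ε₁` and `1/ε₂` works; from here on only `key₁`, `key₂` and
  -- positivity matter.
  have hC : 0 < ε₁⁻¹ + ε₂⁻¹ := by positivity
  generalize ε₁⁻¹ + ε₂⁻¹ = C at key₁ key₂ hC
  refine ⟨C, hC, fun r => ?_⟩
  induction r with
  | zero =>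
    intro h
    rcases le_or_gt (g h) (1 - ε₁) with h1 | h1
    · exact (key₁ h h1).trans (hmem _ _ _).1
    · rw [truncCounter, h_leaf h h1]
      have := mul_nonneg hC.le (sub_nonneg.2 (M.safeInf_le_one π (M.litSet A) h))
      linarith
  | succ r ih =>
    intro h
    rcases le_or_gt (g h) (1 - ε₂) with h1 | h1
    · exact (key₂ h h1).trans (hmem _ _ _).1
    · rw [truncCounter_succ, if_pos (hA _ h h1)]
      split_ifs
      · have := mul_nonneg hC.le (sub_nonneg.2 (M.safeInf_le_one π (M.litSet A) h))
        linarith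
      · calc 1 - C * (1 - g h) ≤ 1 - C * (1 - M.expect π g h) := by
              have := M.safeInf_le_expect π (M.litSet A) h
              gcongr
          _ = M.expect π (fun h => 1 - C * (1 - g h)) h := by
              rw [expect_sub, expect_const_mul, expect_sub, expect_const]
          _ ≤ _ := M.expect_mono π fun s => ih _

/-- `leaf` gives the counter `1` to path formulas whose left operands have literal projections that
are invariant with probability close to `1`. -/
def GoodLeaf (ε : ℝ) (Φ : CPCTL AP) (leaf : History S → CPCTL AP → ℝ) : Prop :=
  ∀ q A B, .prob q A B ∈ Φ.subformulas → q ≠ 0 → ∀ h,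
    1 - ε < M.safeInf π (M.litSet A) h → leaf h (.prob q A B) = 1

variable {ε : ℝ} {Φ : CPCTL AP}

/-- Near-certain invariance of the literals forces satisfaction at every horizon. For a probability
operator, the literal projection is that of its left operand, whose satisfaction makes the linear
bound available; thresholds below `1` leave room for the loss. -/
theorem truncSat_of_safeInf (hl : ∀ h Ψ, leaf h Ψ ∈ Set.Icc 0 1) (hε : 0 < ε)
    (h_leaf : M.GoodLeaf π ε Φ leaf)
    (hlt : ∀ q A B, CPCTL.prob q A B ∈ Φ.subformulas → q < 1)
    {Ψ : CPCTL AP} (hΨ : Ψ ∈ Φ.subformulas) :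
    ∃ ε' > 0, ∀ r h, 1 - ε' < M.safeInf π (M.litSet Ψ) h → M.TruncSat π leaf r h Ψ := by
  have hin : ∀ (D : Set (History S)) h, 1 - 1 < M.safeInf π D h → h ∈ D := by
    intro D h h1
    by_contra h2
    rw [M.safeInf_eq_zero π D h2] at h1
    norm_num at h1
  induction Ψ with
  | atom a => exact ⟨1, one_pos, fun r h h1 => (M.truncSat_atom π r h a).2 (hin _ _ h1)⟩
  | natom a => exact ⟨1, one_pos, fun r h h1 => (M.truncSat_natom π r h a).2 (hin _ _ h1)⟩
  | and A B ihA ihB =>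
    obtain ⟨a, ha, hA⟩ := ihA (CPCTL.subformulas_trans (CPCTL.and_left_mem_subformulas A B) hΨ)
    obtain ⟨b, hb, hB⟩ := ihB (CPCTL.subformulas_trans (CPCTL.and_right_mem_subformulas A B) hΨ)
    refine ⟨min a b, lt_min ha hb, fun r h h1 => (M.truncSat_and π r h A B).2 ⟨hA r h ?_, hB r h ?_⟩⟩
    · have := M.safeInf_mono π (D := M.litSet (.and A B)) (E := M.litSet A) (fun _ h => h.1) h
      linarith [min_le_left a b]
    · have := M.safeInf_mono π (D := M.litSet (.and A B)) (E := M.litSet B) (fun _ h => h.2) h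
      linarith [min_le_right a b]
  | prob q A B ihA ihB =>
    by_cases hq : q = 0
    · subst hq
      refine ⟨1, one_pos, fun r h _ => (M.truncSat_prob π r h _ A B).2 ?_⟩
      exact (M.truncCounter_mem_Icc π hl r h _).1
    · obtain ⟨a, ha, hA⟩ := ihA (CPCTL.subformulas_trans (CPCTL.left_mem_subformulas _ _ _) hΨ)
      obtain ⟨C, hC, h1⟩ := M.le_truncCounter π hl hε ha (h_leaf q A B hΨ hq) hA
      have hq1 : (q : ℝ) < 1 := hlt q A B hΨ
      -- With this `ε'` the loss `C * (1 - g)` is at most `1 - q`.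
      refine ⟨(1 - q) / C, div_pos (by linarith) hC, fun r h h2 => ?_⟩
      rw [litSet_prob M hq] at h2
      rw [truncSat_prob]
      refine le_trans ?_ (h1 r h)
      have h3 : C * (1 - M.safeInf π (M.litSet A) h) ≤ C * ((1 - q) / C) := by
        gcongr
        linarith
      rw [mul_div_cancel₀ _ hC.ne'] at h3
      linarith

/-- Satisfaction in the chain induced by `π` after raising the thresholds by `d`. -/
def RaisedSat (d : CPCTL AP → unitInterval) (h : History S) (Ψ : CPCTL AP) : Prop :=
  (M.induced π).Sat (Ψ.withThresholds d).toPCTL h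

variable {d : CPCTL AP → unitInterval}

theorem le_weakUntilValue_of_raisedSat {q : unitInterval} {A B : CPCTL AP} {h : History S}
    (hs : M.RaisedSat π d h (.prob q A B)) (k : ℕ) :
    (d (.prob q A B) : ℝ) ≤
      M.weakUntilValue π {h | M.RaisedSat π d h A} {h | M.RaisedSat π d h B} k h :=
  M.le_weakUntilValue_of_sat π hs k

/-- Raised thresholds are positive, so the weak until has positive probability and its left operand
must hold at the current position. -/
theorem litSat_of_raisedSat (hd : ∀ q A B, .prob q A B ∈ Φ.subformulas → q < d (.prob q A B))
    {Ψ : CPCTL AP} (hΨ : Ψ ∈ Φ.subformulas) {h : History S} (hs : M.RaisedSat π d h Ψ) :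
    M.LitSat h.last Ψ := by
  induction Ψ with
  | atom a => simpa [RaisedSat, CPCTL.withThresholds, CPCTL.toPCTL, MarkovChain.Sat, LitSat, induced] using hs
  | natom a => simpa [RaisedSat, CPCTL.withThresholds, CPCTL.toPCTL, MarkovChain.Sat, LitSat, induced] using hs
  | and A B ihA ihB =>
    rw [RaisedSat, CPCTL.withThresholds, CPCTL.toPCTL, MarkovChain.Sat] at hs
    exact ⟨ihA (CPCTL.subformulas_trans (CPCTL.and_left_mem_subformulas A B) hΨ) hs.1,
      ihB (CPCTL.subformulas_trans (CPCTL.and_right_mem_subformulas A B) hΨ) hs.2⟩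
  | prob q A B ihA ihB =>
    refine Or.inr (ihA (CPCTL.subformulas_trans (CPCTL.left_mem_subformulas _ _ _) hΨ) ?_)
    have h1 := M.le_weakUntilValue_of_raisedSat π hs 1
    by_contra hA
    rw [weakUntilValue, if_pos (show h ∉ {h | M.RaisedSat π d h A} from hA)] at h1
    have h2 : (q : ℝ) < d (.prob q A B) := hd q A B hΨ
    linarith [q.2.1]

/-- Unfolding the weak until for `t` steps costs only the runs that are in `TA \ TB` up to time `t`
but not forever: at `t = 0` this is the uniform bound `h0`, and each further step averages the
estimate over the successors. -/
theorem eventually_le_truncCounter (hl : ∀ h Ψ, leaf h Ψ ∈ Set.Icc 0 1) {q : unitInterval}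
    {A B : CPCTL AP} {TA TB : Set (History S)} {C : ℝ} (hC : 0 < C)
    (hA : ∀ h ∈ TA, ∀ᶠ r in atTop, M.TruncSat π leaf r h A)
    (hB : ∀ h ∈ TB, ∀ᶠ r in atTop, M.TruncSat π leaf r h B)
    (h0 : ∀ r h, 1 - C * (1 - M.safeInf π (TA \ TB) h) ≤ M.truncCounter π leaf r h (.prob q A B))
    (t : ℕ) (h : History S) :
    ∀ᶠ r in atTop, M.weakUntilValue π TA TB t h -
        C * (M.safe π (TA \ TB) t h - M.safeInf π (TA \ TB) h) ≤
      M.truncCounter π leaf r h (.prob q A B) := by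
  have hmem := M.truncCounter_mem_Icc π hl
  induction t generalizing h with
  | zero => exact Eventually.of_forall fun r => h0 r h
  | succ t ih =>
    rw [weakUntilValue, safe]
    by_cases h1 : h ∈ TA
    swap
    · have h2 : h ∉ TA \ TB := fun h => h1 h.1
      rw [if_pos h1, if_neg h2, M.safeInf_eq_zero π _ h2]
      refine Eventually.of_forall fun r => ?_
      have := (hmem r h (.prob q A B)).1
      simpa using this
    rw [if_neg (not_not.2 h1)]
    by_cases h2 : h ∈ TB
    · have h3 : h ∉ TA \ TB := fun h => h.2 h2
      rw [if_pos h2, if_neg h3, M.safeInf_eq_zero π _ h3]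
      filter_upwards [hA h h1, hB h h2, eventually_ge_atTop 1] with r hr1 hr2 hr
      obtain ⟨r, rfl⟩ := Nat.exists_eq_add_of_le' hr
      rw [truncCounter_succ, if_pos hr1, if_pos hr2]
      simp
    · rw [if_neg h2, if_pos ⟨h1, h2⟩]
      -- Finitely many successors, hence one threshold on `r` for all of them.
      obtain ⟨N, hN⟩ := eventually_atTop.1 (eventually_all.2 fun s => ih (h.snoc s))
      filter_upwards [hA h h1, eventually_ge_atTop (N + 1)] with r hr1 hr
      obtain ⟨r, rfl⟩ := Nat.exists_eq_add_of_le' (le_of_add_le_right hr)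
      have h4 := M.safeInf_le_expect π (TA \ TB) h
      rw [truncCounter_succ, if_pos hr1]
      have h5 : M.expect π (M.weakUntilValue π TA TB t) h -
          C * (M.expect π (M.safe π (TA \ TB) t) h - M.safeInf π (TA \ TB) h) ≤
          M.expect π (fun h' => M.truncCounter π leaf r h' (.prob q A B)) h := calc
        _ ≤ M.expect π (M.weakUntilValue π TA TB t) h - C * (M.expect π (M.safe π (TA \ TB) t) h -
              M.expect π (M.safeInf π (TA \ TB)) h) := by gcongr
        _ = M.expect π (fun h => M.weakUntilValue π TA TB t h -
              C * (M.safe π (TA \ TB) t h - M.safeInf π (TA \ TB) h)) h := by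
            rw [expect_sub, expect_const_mul, expect_sub]
        _ ≤ _ := M.expect_mono π fun s => hN r (by omega) s
      split_ifs
      -- The truncated semantics may accept `B` although `h ∉ TB`; this only raises the counter to
      -- `1`.
      · exact h5.trans (M.expect_mem_Icc π (fun h' => hmem r h' _) h).2
      · exact h5

theorem eventually_truncSat (hl : ∀ h Ψ, leaf h Ψ ∈ Set.Icc 0 1) (hε : 0 < ε)
    (h_leaf : M.GoodLeaf π ε Φ leaf)
    (hd : ∀ q A B, .prob q A B ∈ Φ.subformulas → q < d (.prob q A B))
    {Ψ : CPCTL AP} (hΨ : Ψ ∈ Φ.subformulas) {h : History S} (hs : M.RaisedSat π d h Ψ) :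
    ∀ᶠ r in atTop, M.TruncSat π leaf r h Ψ := by
  induction Ψ generalizing h with
  | atom a =>
    refine Eventually.of_forall fun r => (M.truncSat_atom π r h a).2 ?_
    exact M.litSat_of_raisedSat π hd hΨ hs
  | natom a =>
    refine Eventually.of_forall fun r => (M.truncSat_natom π r h a).2 ?_
    exact M.litSat_of_raisedSat π hd hΨ hs
  | and A B ihA ihB =>
    rw [RaisedSat, CPCTL.withThresholds, CPCTL.toPCTL, MarkovChain.Sat] at hs
    filter_upwards [ihA (CPCTL.subformulas_trans (CPCTL.and_left_mem_subformulas A B) hΨ) hs.1,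
      ihB (CPCTL.subformulas_trans (CPCTL.and_right_mem_subformulas A B) hΨ) hs.2] with r h1 h2
    exact (M.truncSat_and π r h A B).2 ⟨h1, h2⟩
  | prob q A B ihA ihB =>
    simp_rw [truncSat_prob]
    by_cases hq : q = 0
    · subst hq
      exact Eventually.of_forall fun r => (M.truncCounter_mem_Icc π hl r h _).1
    have hAΦ := CPCTL.subformulas_trans (CPCTL.left_mem_subformulas q A B) hΨ
    have hBΦ := CPCTL.subformulas_trans (CPCTL.right_mem_subformulas q A B) hΨ
    have hlt : ∀ q A B, CPCTL.prob q A B ∈ Φ.subformulas → q < 1 := fun q A B h =>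
      (hd q A B h).trans_le unitInterval.le_one'
    obtain ⟨a, ha, hA⟩ := M.truncSat_of_safeInf π hl hε h_leaf hlt hAΦ
    obtain ⟨C, hC, h1⟩ := M.le_truncCounter π hl hε ha (h_leaf q A B hΨ hq) hA
    set TA := {h | M.RaisedSat π d h A}
    set TB := {h | M.RaisedSat π d h B}
    have h2 : ∀ r h, 1 - C * (1 - M.safeInf π (TA \ TB) h) ≤
        M.truncCounter π leaf r h (.prob q A B) := fun r h => by
      refine le_trans ?_ (h1 r h)
      have : TA \ TB ⊆ M.litSet A := fun h h' => M.litSat_of_raisedSat π hd hAΦ h'.1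
      have := M.safeInf_mono π this h
      gcongr
    have h3 := M.eventually_le_truncCounter (TA := TA) (TB := TB) π hl hC (fun h h' => ihA hAΦ h')
      (fun h h' => ihB hBΦ h') h2
    have h4 : Tendsto (fun t => C * (M.safe π (TA \ TB) t h - M.safeInf π (TA \ TB) h)) atTop
        (𝓝 0) := by
      simpa using ((M.tendsto_safe π (TA \ TB) h).sub_const (M.safeInf π (TA \ TB) h)).const_mul C
    -- The Slater slack: `t` is chosen first, to push the loss below it, and only then `r` is taken
    -- large.
    have h5 : (0 : ℝ) < d (.prob q A B) - q := sub_pos.2 (hd q A B hΨ)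
    obtain ⟨t, ht⟩ := (h4.eventually (gt_mem_nhds h5)).exists
    filter_upwards [h3 t h] with r hr
    have := M.le_weakUntilValue_of_raisedSat π hs t
    linarith

end MDP

end Truncation

-- From nearly sure to almost sure invariance in a finite MDP

section Invariance

open Filter Topology MeasureTheory

variable {S AP : Type*} {Act : S → Type*}

theorem CPCTL.finite_subformulas (Φ : CPCTL AP) : Φ.subformulas.Finite := by
  induction Φ with
  | atom a => exact Set.finite_singleton _
  | natom a => exact Set.finite_singleton _
  | and A B ihA ihB => exact (Set.finite_singleton _).union (ihA.union ihB)
  | prob q A B ihA ihB => exact (Set.toFinite _).union (ihA.union ihB)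

namespace MDP

/-- The states from which some strategy stays in `B` surely for the next `k` positions. -/
def win (M : MDP S Act AP) (B : Set S) : ℕ → Set S
  | 0 => Set.univ
  | k + 1 => {s | s ∈ B ∧ ∃ a, ∀ s', M.P s a s' ≠ 0 → s' ∈ M.win B k}

theorem win_succ_subset (M : MDP S Act AP) (B : Set S) (k : ℕ) : M.win B (k + 1) ⊆ M.win B k := by
  induction k with
  | zero => exact Set.subset_univ _
  | succ k ih =>
    rintro s ⟨hs, a, ha⟩
    exact ⟨hs, a, fun s' h => ih (ha s' h)⟩

theorem exists_win_succ_eq [Finite S] (M : MDP S Act AP) (B : Set S) :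
    ∃ k, M.win B (k + 1) = M.win B k := by
  have h : Antitone (M.win B) := antitone_nat_of_succ_le (M.win_succ_subset B)
  obtain ⟨n, hn⟩ := WellFoundedGT.monotone_chain_condition
    (⟨fun k => OrderDual.toDual (M.win B k), fun _ _ hab => h hab⟩ : ℕ →o (Set S)ᵒᵈ)
  exact ⟨n, (hn (n + 1) n.le_succ).symm⟩

/-- At a fixed point of `win`, a memoryless choice of safe actions never leaves the winning set. The
same policy serves every formula whose literal projection holds on `B`. -/
theorem sat_globally_alit_of_win_eq [∀ s, Nonempty (Act s)] (M : MDP S Act AP) {B : Set S} {k : ℕ}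
    (hk : M.win B (k + 1) = M.win B k) :
    ∃ π : Policy Act, ∀ s ∈ M.win B k, ∀ Ψ : CPCTL AP, (∀ s ∈ B, M.LitSat s Ψ) →
      (M.induced π).Sat (.prob 1 (.globally Ψ.alit)) (History.single s) := by
  classical
  have h1 : ∀ s, ∃ a : Act s, s ∈ M.win B k → ∀ s', M.P s a s' ≠ 0 → s' ∈ M.win B k := by
    intro s
    by_cases hs : s ∈ M.win B k
    · rw [← hk] at hs
      exact hs.2.imp fun a ha _ => ha
    · exact ⟨Classical.arbitrary _, fun h => absurd h hs⟩
  choose act hact using h1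
  refine ⟨fun h => PMF.pure (act h.last), fun s hs Ψ hΨ => ?_⟩
  set C := M.induced fun h => PMF.pure (act h.last) with hC
  have hW : ∀ h ∈ {h : History S | h.last ∈ M.win B k},
      ∀ᵐ h' ∂(C.step h).toMeasure, h' ∈ {h : History S | h.last ∈ M.win B k} := by
    intro h hh
    rw [ae_iff]
    change (C.step h).toMeasure {h' | h' ∉ {h : History S | h.last ∈ M.win B k}} = 0
    rw [PMF.toMeasure_apply_eq_zero_iff _ MeasurableSet.of_discrete, Set.disjoint_left]
    intro h' h1 h2
    apply h2
    simp only [hC, induced, PMF.pure_bind, PMF.support_map, Set.mem_image, PMF.mem_support_iff]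
      at h1
    obtain ⟨s', h3, rfl⟩ := h1
    exact hact h.last hh s' h3
  rw [MarkovChain.Sat, measureReal_def, Set.Icc.coe_one, ← ENNReal.toReal_one]
  refine ENNReal.toReal_mono (measure_ne_top _ _) ?_
  rw [← measure_univ (μ := C.pathMeasure (History.single s))]
  refine measure_mono_ae ?_
  filter_upwards [C.pathMeasure_forall_mem hW (q := History.single s) hs] with ξ hξ _
  refine Or.inr fun j => (M.sat_alit _ Ψ (ξ j)).2 (hΨ _ ?_)
  have := hξ j
  -- Only `win B (k + 1)` visibly lies in `B`; `win B 0` is everything.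
  rw [← hk] at this
  exact this.1

variable [Fintype S] [∀ s, Fintype (Act s)] (M : MDP S Act AP)

theorem exists_pos_le_transition :
    ∃ η : ℝ, 0 < η ∧ η ≤ 1 ∧ ∀ s a s', M.P s a s' ≠ 0 → η ≤ (M.P s a s').toReal := by
  have h : ∀ᶠ η : ℝ in 𝓝[>] 0, ∀ s a s', M.P s a s' ≠ 0 → η ≤ (M.P s a s').toReal := by
    refine eventually_all.2 fun s => eventually_all.2 fun a => eventually_all.2 fun s' => ?_
    by_cases h : M.P s a s' = 0
    · exact Eventually.of_forall fun _ h' => absurd h h'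
    · have h1 : 0 < (M.P s a s').toReal := ENNReal.toReal_pos h (PMF.apply_ne_top _ _)
      filter_upwards [nhdsWithin_le_nhds (gt_mem_nhds h1)] with η hη _ using hη.le
  have h1 : ∀ᶠ η : ℝ in 𝓝[>] 0, η ≤ 1 := by
    filter_upwards [nhdsWithin_le_nhds (gt_mem_nhds (zero_lt_one' ℝ))] with η hη using hη.le
  obtain ⟨η, h2, h3, h4⟩ := (h.and (h1.and self_mem_nhdsWithin)).exists
  exact ⟨η, h4, h3, h2⟩

/-- Outside the winning set every action has a successor, of probability at least `η`, outside the
winning set of one step less. Randomising over actions does not help, so `B` is left with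
probability at least `η ^ k`. -/
theorem safe_le_of_notMem_win {η : ℝ} (h0 : 0 < η) (h1 : η ≤ 1)
    (hη : ∀ s a s', M.P s a s' ≠ 0 → η ≤ (M.P s a s').toReal) (π : Policy Act) (B : Set S)
    (k : ℕ) {h : History S} (hh : h.last ∉ M.win B k) :
    M.safe π {h | h.last ∈ B} k h ≤ 1 - η ^ k := by
  induction k generalizing h with
  | zero => exact absurd (Set.mem_univ _) hh
  | succ k ih =>
    rw [safe]
    split_ifs with hB
    · set f := M.safe π {h | h.last ∈ B} k
      have h2 : 1 - M.expect π f h = M.expect π (fun h => 1 - f h) h := by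
        rw [expect_sub, expect_const]
      suffices η ^ (k + 1) ≤ M.expect π (fun h => 1 - f h) h by linarith
      calc η ^ (k + 1) = ∑ a, (π h a).toReal * η ^ (k + 1) := by
            rw [← Finset.sum_mul, PMF.sum_toReal, one_mul]
        _ ≤ _ := by
            refine Finset.sum_le_sum fun a _ => ?_
            simp_rw [mul_assoc, ← Finset.mul_sum]
            refine mul_le_mul_of_nonneg_left ?_ ENNReal.toReal_nonneg
            have h3 : ∃ s', M.P h.last a s' ≠ 0 ∧ s' ∉ M.win B k := by
              by_contra! h3
              exact hh ⟨hB, a, h3⟩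
            obtain ⟨s', h4, h5⟩ := h3
            refine le_trans ?_ (Finset.single_le_sum (f := fun s => (M.P h.last a s).toReal *
              (1 - f (h.snoc s))) (fun s _ => mul_nonneg ENNReal.toReal_nonneg
                (sub_nonneg.2 (M.safe_le_one π _ k _))) (Finset.mem_univ s'))
            have h6 : f (h.snoc s') ≤ 1 - η ^ k := ih h5
            rw [pow_succ']
            exact mul_le_mul (hη _ _ _ h4) (by linarith) (by positivity) ENNReal.toReal_nonneg
    · exact sub_nonneg.2 (pow_le_one₀ h0.le h1)

/-- An invariance probability above `1 - η ^ k` puts the last state in the stabilised winning set of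
`B`. One `ε` works for all `B`, as `S` has finitely many subsets. -/
theorem exists_policy_of_safeInf [∀ s, Nonempty (Act s)] :
    ∃ ε > 0, ∀ (B : Set S) (π : Policy Act) (h : History S),
      1 - ε < M.safeInf π {h | h.last ∈ B} h →
      ∃ π' : Policy Act, ∀ Ψ : CPCTL AP, (∀ s ∈ B, M.LitSat s Ψ) →
        (M.induced π').Sat (.prob 1 (.globally Ψ.alit)) (History.single h.last) := by
  obtain ⟨η, h0, h1, hη⟩ := M.exists_pos_le_transition
  have h2 : ∀ B : Set S, ∀ᶠ ε : ℝ in 𝓝[>] 0, ∀ (π : Policy Act) (h : History S),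
      1 - ε < M.safeInf π {h | h.last ∈ B} h →
      ∃ π' : Policy Act, ∀ Ψ : CPCTL AP, (∀ s ∈ B, M.LitSat s Ψ) →
        (M.induced π').Sat (.prob 1 (.globally Ψ.alit)) (History.single h.last) := by
    intro B
    obtain ⟨k, hk⟩ := M.exists_win_succ_eq B
    obtain ⟨π', hπ'⟩ := M.sat_globally_alit_of_win_eq hk
    filter_upwards [nhdsWithin_le_nhds (gt_mem_nhds (pow_pos h0 k))] with ε hε π h hh
    refine ⟨π', fun Ψ hΨ => hπ' _ ?_ Ψ hΨ⟩
    by_contra hc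
    have h3 := M.safe_le_of_notMem_win h0 h1 hη π B k hc
    have h4 := M.safeInf_le_safe π {h | h.last ∈ B} k h
    linarith
  obtain ⟨ε, h3, h4⟩ := ((eventually_all.2 h2).and self_mem_nhdsWithin).exists
  exact ⟨ε, h4, h3⟩

theorem expect_finsetSum {ι : Type*} (π : Policy Act) (J : Finset ι) (f : ι → History S → ℝ)
    (h : History S) :
    M.expect π (fun h => ∑ i ∈ J, f i h) h = ∑ i ∈ J, M.expect π (f i) h := by
  classical
  induction J using Finset.induction_on with
  | empty => simp [expect_const]
  | insert i J hi ih => simp only [Finset.sum_insert hi, expect_add, ih]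

theorem one_sub_safe_iInter_le {ι : Type*} (π : Policy Act) (J : Finset ι)
    (D : ι → Set (History S)) (k : ℕ) (h : History S) :
    1 - M.safe π (⋂ i ∈ J, D i) k h ≤ ∑ i ∈ J, (1 - M.safe π (D i) k h) := by
  induction k generalizing h with
  | zero => simp [safe]
  | succ k ih =>
    have hnn : ∀ i ∈ J, 0 ≤ 1 - M.safe π (D i) (k + 1) h := fun i _ =>
      sub_nonneg.2 (M.safe_le_one π _ _ h)
    by_cases hD : h ∈ ⋂ i ∈ J, D i
    · have hD' : ∀ i ∈ J, h ∈ D i := by simpa using hD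
      have h1 : ∑ i ∈ J, (1 - M.safe π (D i) (k + 1) h) =
          ∑ i ∈ J, M.expect π (fun h => 1 - M.safe π (D i) k h) h :=
        Finset.sum_congr rfl fun i hi => by
          rw [safe, if_pos (hD' i hi), expect_sub, expect_const]
      rw [h1, ← expect_finsetSum, safe, if_pos hD]
      nth_rw 1 [← M.expect_const π 1 h]
      rw [← expect_sub]
      exact M.expect_mono π fun s => ih _
    · obtain ⟨i, hi, hiD⟩ : ∃ i ∈ J, h ∉ D i := by simpa using hD
      refine le_trans ?_ (Finset.single_le_sum hnn hi)
      rw [safe, if_neg hD, safe, if_neg hiD]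

/-- An initial profile requires one policy for all its counters. By a union bound, the literal
projections that are each nearly surely invariant are nearly surely invariant together, and the
previous gap applies to their conjunction. -/
theorem exists_joint_policy [∀ s, Nonempty (Act s)] (Φ : CPCTL AP) :
    ∃ ε > 0, ∀ (π : Policy Act) (h : History S),
      ∃ π' : Policy Act, ∀ q A B, .prob q A B ∈ Φ.subformulas → q ≠ 0 →
        1 - ε < M.safeInf π (M.litSet A) h →
        (M.induced π').Sat (.prob 1 (.globally (CPCTL.prob q A B).alit))
          (History.single h.last) := by
  classical
  obtain ⟨ε, hε, H⟩ := M.exists_policy_of_safeInf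
  set F := Φ.finite_subformulas.toFinset
  -- At most `F.card` failure probabilities are added; the extra `1` makes the sum strictly less
  -- than `ε`.
  refine ⟨ε / (F.card + 1), by positivity, fun π h => ?_⟩
  set J := F.filter fun Ψ => 1 - ε / (F.card + 1) < M.safeInf π (M.litSet Ψ) h with hJ
  have hset : (⋂ Ψ ∈ J, M.litSet Ψ) = {h | h.last ∈ {s | ∀ Ψ ∈ J, M.LitSat s Ψ}} := by
    ext h
    simp [litSet]
  have h1 : 1 - ε < M.safeInf π (⋂ Ψ ∈ J, M.litSet Ψ) h := by
    have h2 : ∀ k, 1 - ∑ Ψ ∈ J, (1 - M.safeInf π (M.litSet Ψ) h) ≤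
        M.safe π (⋂ Ψ ∈ J, M.litSet Ψ) k h := fun k => by
      have h3 := M.one_sub_safe_iInter_le π J M.litSet k h
      have h4 : ∑ Ψ ∈ J, (1 - M.safe π (M.litSet Ψ) k h) ≤
          ∑ Ψ ∈ J, (1 - M.safeInf π (M.litSet Ψ) h) :=
        Finset.sum_le_sum fun Ψ _ => sub_le_sub_left (M.safeInf_le_safe π _ k h) 1
      linarith
    refine lt_of_lt_of_le ?_ (le_ciInf h2)
    have h5 : ∑ Ψ ∈ J, (1 - M.safeInf π (M.litSet Ψ) h) ≤ J.card • (ε / (F.card + 1)) :=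
      Finset.sum_le_card_nsmul _ _ _ fun Ψ hΨ => by
        have := (Finset.mem_filter.1 hΨ).2
        linarith
    have h6 : J.card • (ε / (F.card + 1)) < ε := by
      have h7 : (J.card : ℝ) ≤ F.card := by exact_mod_cast Finset.card_filter_le _ _
      rw [nsmul_eq_mul, mul_div_assoc', div_lt_iff₀ (by positivity)]
      nlinarith
    linarith
  rw [hset] at h1
  obtain ⟨π', hπ'⟩ := H _ π h h1
  refine ⟨π', fun q A B hΨ hq hA => hπ' _ fun s hs => Or.inr (hs A ?_)⟩
  rw [hJ, Finset.mem_filter]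
  exact ⟨Φ.finite_subformulas.mem_toFinset.2
    (CPCTL.subformulas_trans (CPCTL.left_mem_subformulas q A B) hΨ), hA⟩

end MDP

end Invariance

-- Maximal profiles, compactness, and domination by the value frontier

section Frontier

variable {S AP : Type*} {Act : S → Type*}

instance (Φ : CPCTL AP) : Finite (SF Φ) := Φ.finite_subformulas.to_subtype

theorem PF.formula_injective {Φ : CPCTL AP} : Function.Injective (PF.formula (Φ := Φ)) :=
  fun i j h => by
    cases i
    cases j
    simpa [PF.formula] using h

instance (Φ : CPCTL AP) : Finite (PF Φ) :=
  Finite.of_injective (PF.stateSF (Φ := Φ)) fun _ _ h =>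
    PF.formula_injective (congrArg Subtype.val h)

/-- The extension by zero of counters to all formulas. -/
noncomputable def PF.extend {Φ : CPCTL AP} (ν : PF Φ → unitInterval) : CPCTL AP → ℝ :=
  Function.extend PF.formula (fun j => (ν j : ℝ)) 0

theorem PF.extend_formula {Φ : CPCTL AP} (ν : PF Φ → unitInterval) (j : PF Φ) :
    PF.extend ν j.formula = ν j :=
  PF.formula_injective.extend_apply _ _ j

theorem PF.extend_mem_Icc {Φ : CPCTL AP} (ν : PF Φ → unitInterval) (Ψ : CPCTL AP) :
    PF.extend ν Ψ ∈ Set.Icc 0 1 := by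
  by_cases h : ∃ j : PF Φ, j.formula = Ψ
  · obtain ⟨j, rfl⟩ := h
    rw [PF.extend_formula]
    exact (ν j).2
  · rw [PF.extend, Function.extend_apply' _ _ _ h]
    exact ⟨le_rfl, zero_le_one⟩

open Classical in
/-- The restriction to the subformulas of `Φ` of truth values and values in `[0, 1]`. -/
noncomputable def Profile.mk (Φ : CPCTL AP) (p : CPCTL AP → Prop) (ν : CPCTL AP → ℝ)
    (hν : ∀ Ψ, ν Ψ ∈ Set.Icc (0 : ℝ) 1) : Profile Φ :=
  (fun i => decide (p i.1), fun j => ⟨ν j.formula, hν j.formula⟩)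

theorem Profile.mk_fst_eq_true {Φ : CPCTL AP} {p : CPCTL AP → Prop} {ν : CPCTL AP → ℝ}
    {hν : ∀ Ψ, ν Ψ ∈ Set.Icc (0 : ℝ) 1} {i : SF Φ} :
    (Profile.mk Φ p ν hν).1 i = true ↔ p i.1 := by
  simp [Profile.mk]

theorem Profile.mk_fst_eq_false {Φ : CPCTL AP} {p : CPCTL AP → Prop} {ν : CPCTL AP → ℝ}
    {hν : ∀ Ψ, ν Ψ ∈ Set.Icc (0 : ℝ) 1} {i : SF Φ} :
    (Profile.mk Φ p ν hν).1 i = false ↔ ¬ p i.1 := by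
  simp [Profile.mk]

theorem Profile.le_mk {Φ : CPCTL AP} {p : CPCTL AP → Prop} {ν : CPCTL AP → ℝ}
    {hν : ∀ Ψ, ν Ψ ∈ Set.Icc (0 : ℝ) 1} {x : Profile Φ} (h1 : ∀ i, x.1 i = true → p i.1)
    (h2 : ∀ j, (x.2 j : ℝ) ≤ ν j.formula) : x ≤ Profile.mk Φ p ν hν :=
  ⟨fun i => Bool.le_iff_imp.2 fun h => Profile.mk_fst_eq_true.2 (h1 i h), h2⟩

instance : OrderClosedTopology Bool := ⟨isClosed_discrete _⟩

/-- Every set of profiles whose closure it dominates has a maximal element above each element. -/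
theorem Profile.exists_le_maximal {Φ : CPCTL AP} {X : Set (Profile Φ)}
    (hX : ∀ x ∈ closure X, ∃ y ∈ X, x ≤ y) {x : Profile Φ} (hx : x ∈ X) :
    ∃ m, x ≤ m ∧ Maximal (· ∈ X) m := by
  refine zorn_le_nonempty₀ X (fun c hc hchain z hz => ?_) x hx
  have : Nonempty c := ⟨⟨z, hz⟩⟩
  -- A limit point above the whole chain exists by compactness; it lies only in the closure of `X`,
  -- and `hX` replaces it by a larger element of `X`.
  have h1 : (⋂ y : c, closure X ∩ Set.Ici (y : Profile Φ)).Nonempty := by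
    refine IsCompact.nonempty_iInter_of_directed_nonempty_isCompact_isClosed _ ?_ ?_ ?_ ?_
    · intro a b
      rcases hchain.total a.2 b.2 with h | h
      · exact ⟨b, Set.inter_subset_inter_right _ (Set.Ici_subset_Ici.2 h), subset_rfl⟩
      · exact ⟨a, subset_rfl, Set.inter_subset_inter_right _ (Set.Ici_subset_Ici.2 h)⟩
    · exact fun a => ⟨a, subset_closure (hc a.2), Set.mem_Ici.2 le_rfl⟩
    · exact fun a => (isClosed_closure.inter isClosed_Ici).isCompact
    · exact fun a => isClosed_closure.inter isClosed_Ici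
  obtain ⟨w, hw⟩ := h1
  rw [Set.mem_iInter] at hw
  obtain ⟨y, hy, hwy⟩ := hX w (hw ⟨z, hz⟩).1
  exact ⟨y, hy, fun b hb => (hw ⟨b, hb⟩).2.trans hwy⟩

namespace MDP

variable [Fintype S] [∀ s, Fintype (Act s)] (M : MDP S Act AP) {Φ : CPCTL AP} {s : S}

/-- The inequalities that characterise the profiles below a solution of the Bellman conditions. -/
def SubBellman (M : MDP S Act AP) (Φ : CPCTL AP) (s : S) (w : Act s → ℝ) (y : S → Profile Φ)
    (x : Profile Φ) : Prop :=
  (∀ (i : SF Φ) (a : AP), i.1 = .atom a → x.1 i = true → a ∈ M.label s) ∧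
  (∀ (i : SF Φ) (a : AP), i.1 = .natom a → x.1 i = true → a ∉ M.label s) ∧
  (∀ i i₁ i₂ : SF Φ, i.1 = .and i₁.1 i₂.1 → x.1 i = true → x.1 i₁ = true ∧ x.1 i₂ = true) ∧
  (∀ j : PF Φ, x.1 j.stateSF = true → j.thr ≤ x.2 j) ∧
  (∀ j : PF Φ, x.1 j.leftSF = false → x.2 j ≤ 0) ∧
  ∀ j : PF Φ, x.1 j.rightSF = false →
    (x.2 j : ℝ) ≤ ∑ a : Act s, ∑ s' : S, w a * (M.P s a s').toReal * ((y s').2 j : ℝ)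

theorem BellmanCondition.subBellman {M : MDP S Act AP} {δ : PMF (Act s)} {y : S → Profile Φ}
    {x : Profile Φ} (h : M.BellmanCondition Φ s δ y x) :
    M.SubBellman Φ s (fun a => (δ a).toReal) y x := by
  obtain ⟨h1, h2, h3, h4, h5⟩ := h
  refine ⟨fun i a hi => (h1 i a hi).1, fun i a hi => (h2 i a hi).1, fun i i₁ i₂ hi hx => ?_,
    fun j => (h4 j).1, fun j hj => ?_, fun j hj => ?_⟩
  · rw [h3 i i₁ i₂ hi, Bool.and_eq_true] at hx
    exact hx
  · have := h5 j
    rw [if_pos hj] at this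
    exact this.le
  · rw [h5 j]
    split_ifs with h6 h7
    · exact Finset.sum_nonneg fun a _ => Finset.sum_nonneg fun s' _ =>
        mul_nonneg (by positivity) ((y s').2 j).2.1
    · rw [hj] at h7
      exact absurd h7 (by decide)
    · exact le_rfl

theorem bellmanCondition_mk (δ : PMF (Act s)) (y : S → Profile Φ) {e : CPCTL AP → ℝ}
    (hν : ∀ Ψ, M.counter s e Ψ ∈ Set.Icc (0 : ℝ) 1)
    (he : ∀ j : PF Φ, e j.formula =
      ∑ a : Act s, ∑ s' : S, (δ a).toReal * (M.P s a s').toReal * ((y s').2 j : ℝ)) :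
    M.BellmanCondition Φ s δ y (Profile.mk Φ (M.Holds s e) (M.counter s e) hν) := by
  refine ⟨fun i a hi => ?_, fun i a hi => ?_, fun i i₁ i₂ hi => ?_, fun j => ?_, fun j => ?_⟩
  · rw [Profile.mk_fst_eq_true, hi, Holds]
  · rw [Profile.mk_fst_eq_true, hi, Holds]
  · rw [Bool.eq_iff_iff, Bool.and_eq_true]
    simp only [Profile.mk_fst_eq_true]
    rw [hi, Holds]
  · rw [Profile.mk_fst_eq_true]
    rfl
  · rw [← he]
    change M.counter s e (.prob j.thr j.left j.right) = _
    rw [counter]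
    by_cases hA : M.Holds s e j.left
    · rw [if_pos hA, if_neg (mt Profile.mk_fst_eq_false.1 (not_not.2 hA))]
      by_cases hB : M.Holds s e j.right
      · rw [if_pos hB, if_pos (Profile.mk_fst_eq_true.2 hB)]
      · rw [if_neg hB, if_neg (mt Profile.mk_fst_eq_true.1 hB)]
        rfl
    · rw [if_neg hA, if_pos (Profile.mk_fst_eq_false.2 hA)]

/-- `Holds` and `counter`, computed by recursion on formulas, give the greatest profile allowed by
the inequalities: there is no negation above atoms, so larger operands and larger successor counters
only help. -/
theorem SubBellman.le_mk {M : MDP S Act AP} {w : Act s → ℝ} {y y' : S → Profile Φ}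
    {x : Profile Φ} (hw : ∀ a, 0 ≤ w a) (h : M.SubBellman Φ s w y x) (hy : ∀ s', y s' ≤ y' s')
    {e : CPCTL AP → ℝ} (hν : ∀ Ψ, M.counter s e Ψ ∈ Set.Icc (0 : ℝ) 1)
    (he : ∀ j : PF Φ, e j.formula =
      ∑ a : Act s, ∑ s' : S, w a * (M.P s a s').toReal * ((y' s').2 j : ℝ)) :
    x ≤ Profile.mk Φ (M.Holds s e) (M.counter s e) hν := by
  obtain ⟨h1, h2, h3, h4, h5, h6⟩ := h
  have key : ∀ j : PF Φ, (x.1 j.leftSF = true → M.Holds s e j.left) →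
      (x.1 j.rightSF = true → M.Holds s e j.right) → (x.2 j : ℝ) ≤ M.counter s e j.formula := by
    intro j hl hr
    rcases hx : x.1 j.leftSF with _ | _
    · have : (x.2 j : ℝ) ≤ 0 := h5 j hx
      exact this.trans (hν _).1
    · change _ ≤ M.counter s e (.prob j.thr j.left j.right)
      rw [counter, if_pos (hl hx)]
      split_ifs with hB
      · exact (x.2 j).2.2
      · refine (h6 j (by simpa using mt hr hB)).trans (le_of_le_of_eq ?_ (he j).symm)
        exact Finset.sum_le_sum fun a _ => Finset.sum_le_sum fun s' _ =>
          mul_le_mul_of_nonneg_left ((hy s').2 j) (mul_nonneg (hw a) ENNReal.toReal_nonneg)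
  have hsat : ∀ (Ψ : CPCTL AP) (hΨ : Ψ ∈ Φ.subformulas),
      x.1 ⟨Ψ, hΨ⟩ = true → M.Holds s e Ψ := by
    intro Ψ
    induction Ψ with
    | atom a => exact fun hΨ => h1 ⟨_, hΨ⟩ a rfl
    | natom a => exact fun hΨ => h2 ⟨_, hΨ⟩ a rfl
    | and A B ihA ihB =>
      intro hΨ hx
      have hA := CPCTL.subformulas_trans (CPCTL.and_left_mem_subformulas A B) hΨ
      have hB := CPCTL.subformulas_trans (CPCTL.and_right_mem_subformulas A B) hΨ
      have h := h3 ⟨_, hΨ⟩ ⟨A, hA⟩ ⟨B, hB⟩ rfl hx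
      exact ⟨ihA hA h.1, ihB hB h.2⟩
    | prob q A B ihA ihB =>
      intro hΨ hx
      have hq : (q : ℝ) ≤ x.2 ⟨q, A, B, hΨ⟩ := h4 ⟨q, A, B, hΨ⟩ hx
      exact hq.trans
        (key ⟨q, A, B, hΨ⟩ (ihA _) (ihB _))
  exact Profile.le_mk (fun i => hsat i.1 i.2) fun j => key j (hsat _ _) (hsat _ _)

/-- A profile below the Bellman conditions is dominated by a solution of them. -/
theorem SubBellman.exists_le {M : MDP S Act AP} {δ : PMF (Act s)} {y y' : S → Profile Φ}
    {x : Profile Φ} (h : M.SubBellman Φ s (fun a => (δ a).toReal) y x)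
    (hy : ∀ s', y s' ≤ y' s') : ∃ x', x ≤ x' ∧ M.BellmanCondition Φ s δ y' x' := by
  set e : CPCTL AP → ℝ := fun Ψ =>
    ∑ a : Act s, ∑ s' : S, (δ a).toReal * (M.P s a s').toReal * PF.extend (y' s').2 Ψ with he_def
  have he : ∀ j : PF Φ, e j.formula =
      ∑ a : Act s, ∑ s' : S, (δ a).toReal * (M.P s a s').toReal * ((y' s').2 j : ℝ) := fun j => by
    simp only [he_def, PF.extend_formula]
  have he' : ∀ Ψ, e Ψ ∈ Set.Icc (0 : ℝ) 1 := fun Ψ => by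
    refine ⟨Finset.sum_nonneg fun a _ => Finset.sum_nonneg fun s' _ =>
      mul_nonneg (by positivity) (PF.extend_mem_Icc _ _).1, ?_⟩
    rw [← M.sum_weights s δ]
    exact Finset.sum_le_sum fun a _ => Finset.sum_le_sum fun s' _ =>
      mul_le_of_le_one_right (by positivity) (PF.extend_mem_Icc _ _).2
  exact ⟨_, h.le_mk (fun _ => ENNReal.toReal_nonneg) hy (M.counter_mem_Icc s he') he,
    M.bellmanCondition_mk δ y' _ he⟩

/-- The equivalence `μ_i = 1 ↔ ν_j ≥ p_j` is not closed, since counters below `p_j` may tend to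
`p_j` while `μ_i = 0`. Inequalities guarded by a Boolean coordinate are closed, as that coordinate
is locally constant. Real weights in place of a `PMF` allow the compactness of the simplex to be
used. -/
theorem isClosed_subBellman :
    IsClosed {p : (Act s → ℝ) × (S → Profile Φ) × Profile Φ | M.SubBellman Φ s p.1 p.2.1 p.2.2} := by
  have hfst : ∀ i : SF Φ, Continuous fun p : (Act s → ℝ) × (S → Profile Φ) × Profile Φ =>
      p.2.2.1 i := fun i => by fun_prop
  have hsnd : ∀ j : PF Φ, Continuous fun p : (Act s → ℝ) × (S → Profile Φ) × Profile Φ =>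
      p.2.2.2 j := fun j => by fun_prop
  have ho : ∀ (i : SF Φ) (b : Bool),
      IsOpen {p : (Act s → ℝ) × (S → Profile Φ) × Profile Φ | p.2.2.1 i = b} :=
    fun i b => (isOpen_discrete {b}).preimage (hfst i)
  have hc : ∀ (i : SF Φ) (b : Bool),
      IsClosed {p : (Act s → ℝ) × (S → Profile Φ) × Profile Φ | p.2.2.1 i = b} :=
    fun i b => (isClosed_discrete {b}).preimage (hfst i)
  simp only [SubBellman, Set.ofPred_and, Set.ofPred_forall]
  refine .inter ?_ (.inter ?_ (.inter ?_ (.inter ?_ (.inter ?_ ?_))))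
  · exact isClosed_iInter fun i => isClosed_iInter fun a => isClosed_iInter fun _ =>
      isClosed_imp (ho i true) isClosed_const
  · exact isClosed_iInter fun i => isClosed_iInter fun a => isClosed_iInter fun _ =>
      isClosed_imp (ho i true) isClosed_const
  · exact isClosed_iInter fun i => isClosed_iInter fun i₁ => isClosed_iInter fun i₂ =>
      isClosed_iInter fun _ => isClosed_imp (ho i true) ((hc i₁ true).inter (hc i₂ true))
  · exact isClosed_iInter fun j => isClosed_imp (ho _ true) (isClosed_le continuous_const (hsnd j))
  · exact isClosed_iInter fun j => isClosed_imp (ho _ false) (isClosed_le (hsnd j) continuous_const)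
  · refine isClosed_iInter fun j => isClosed_imp (ho _ false) (isClosed_le ?_ ?_)
    · exact continuous_subtype_val.comp (hsnd j)
    · fun_prop

theorem _root_.PMF.exists_toReal_eq {α : Type*} [Fintype α] {w : α → ℝ} (hw : w ∈ stdSimplex ℝ α) :
    ∃ p : PMF α, (fun a => (p a).toReal) = w := by
  refine ⟨PMF.ofFintype (fun a => ENNReal.ofReal (w a)) ?_, ?_⟩
  · rw [← ENNReal.ofReal_sum_of_nonneg fun a _ => hw.1 a, hw.2, ENNReal.ofReal_one]
  · ext a
    exact ENNReal.toReal_ofReal (hw.1 a)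

variable {V : S → Set (Profile Φ)}

/-- The closure of the set of solutions of the Bellman conditions is dominated by this set, if the
closures of the sets `V s'` are dominated by these sets. -/
theorem exists_bellmanCondition_of_mem_closure (hV : ∀ s', ∀ x ∈ closure (V s'), ∃ y ∈ V s', x ≤ y)
    {x : Profile Φ}
    (hx : x ∈ closure {x : Profile Φ | ∃ (δ : PMF (Act s)) (y : S → Profile Φ),
      (∀ s', y s' ∈ V s') ∧ M.BellmanCondition Φ s δ y x}) :
    ∃ x' ∈ {x : Profile Φ | ∃ (δ : PMF (Act s)) (y : S → Profile Φ),
      (∀ s', y s' ∈ V s') ∧ M.BellmanCondition Φ s δ y x}, x ≤ x' := by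
  set G : Set ((Act s → ℝ) × (S → Profile Φ) × Profile Φ) :=
    (stdSimplex ℝ (Act s) ×ˢ ((Set.univ.pi fun s' => closure (V s')) ×ˢ Set.univ)) ∩
      {p | M.SubBellman Φ s p.1 p.2.1 p.2.2} with hG
  have hGc : IsCompact G := by
    refine IsCompact.inter_right ?_ M.isClosed_subBellman
    exact (isCompact_stdSimplex ℝ (Act s)).prod
      ((isCompact_univ_pi fun s' => isClosed_closure.isCompact).prod isCompact_univ)
  have hcl : IsClosed ((fun p => p.2.2) '' G) := (hGc.image (by fun_prop)).isClosed
  have hsub : {x : Profile Φ | ∃ (δ : PMF (Act s)) (y : S → Profile Φ),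
      (∀ s', y s' ∈ V s') ∧ M.BellmanCondition Φ s δ y x} ⊆ (fun p => p.2.2) '' G := by
    rintro x ⟨δ, y, hy, h⟩
    refine ⟨(fun a => (δ a).toReal, y, x), ⟨⟨⟨fun a => ENNReal.toReal_nonneg, δ.sum_toReal⟩,
      fun s' _ => subset_closure (hy s'), trivial⟩, h.subBellman⟩, rfl⟩
  -- A limit of solutions satisfies the inequalities with limiting weights and successors in the
  -- closures; raising these successors into `V` then gives a genuine solution above it.
  obtain ⟨⟨w, y, x⟩, ⟨⟨hw, hy, -⟩, h⟩, rfl⟩ := closure_minimal hsub hcl hx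
  obtain ⟨δ, rfl⟩ := PMF.exists_toReal_eq hw
  choose y' hy' hyy' using fun s' => hV s' (y s') (hy s' trivial)
  obtain ⟨x', hxx', hx'⟩ := SubBellman.exists_le h hyy'
  exact ⟨x', ⟨δ, y', hy', hx'⟩, hxx'⟩

theorem exists_mem_bellman_of_mem_closure
    (hV : ∀ s', ∀ x ∈ closure (V s'), ∃ y ∈ V s', x ≤ y) {x : Profile Φ}
    (hx : x ∈ closure {x : Profile Φ | ∃ (δ : PMF (Act s)) (y : S → Profile Φ),
      (∀ s', y s' ∈ V s') ∧ M.BellmanCondition Φ s δ y x}) :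
    ∃ y ∈ M.bellman Φ V s, x ≤ y := by
  obtain ⟨x', hx', hxx'⟩ := M.exists_bellmanCondition_of_mem_closure hV hx
  obtain ⟨m, hm, hmax⟩ := Profile.exists_le_maximal
    (fun x hx => M.exists_bellmanCondition_of_mem_closure hV hx) hx'
  exact ⟨m, hmax, hxx'.trans hm⟩

theorem valueFrontier_succ (n : ℕ) :
    M.valueFrontier Φ (n + 1) = M.bellman Φ (M.valueFrontier Φ n) :=
  Function.iterate_succ_apply' _ _ _

omit [Fintype S] [∀ s, Fintype (Act s)] in
theorem finite_initialValue : (M.initialValue Φ s).Finite := by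
  refine ((Set.finite_univ (α := SF Φ → Bool)).prod (Set.Finite.pi' fun _ : PF Φ =>
    (Set.toFinite {(0 : unitInterval), 1}))).subset ?_
  rintro x ⟨⟨π, hπ⟩, -⟩
  refine ⟨trivial, fun j => ?_⟩
  rw [hπ j]
  split_ifs <;> simp

theorem exists_mem_valueFrontier_of_mem_closure (n : ℕ) {x : Profile Φ}
    (hx : x ∈ closure (M.valueFrontier Φ n s)) : ∃ y ∈ M.valueFrontier Φ n s, x ≤ y := by
  induction n generalizing s x with
  | zero =>
    have h : IsClosed (M.valueFrontier Φ 0 s) := M.finite_initialValue.isClosed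
    rw [h.closure_eq] at hx
    exact ⟨x, hx, le_rfl⟩
  | succ n ih =>
    rw [valueFrontier_succ] at hx ⊢
    exact M.exists_mem_bellman_of_mem_closure (fun _ _ h => ih h)
      (closure_mono (fun _ h => h.1) hx)

omit [Fintype S] [∀ s, Fintype (Act s)] in
-- `HoldsWith` is the greatest valuation compatible with the counters, hence a maximal one.
theorem mk_mem_initialValue {ν : CPCTL AP → ℝ} (hν : ∀ Ψ, ν Ψ ∈ Set.Icc (0 : ℝ) 1)
    (π : Policy Act) (h1 : ∀ Ψ, (M.induced π).Sat (.prob 1 (.globally Ψ.alit)) (.single s) → ν Ψ = 1)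
    (h0 : ∀ Ψ, ¬ (M.induced π).Sat (.prob 1 (.globally Ψ.alit)) (.single s) → ν Ψ = 0) :
    Profile.mk Φ (M.HoldsWith s ν) ν hν ∈ M.initialValue Φ s := by
  refine ⟨⟨π, fun j => ?_⟩, ⟨?_, ?_, ?_, ?_⟩, ?_⟩
  · split_ifs with h
    · exact Subtype.ext (h1 _ h)
    · exact Subtype.ext (h0 _ h)
  · exact fun j h => Profile.mk_fst_eq_true.1 h
  · intro i i₁ i₂ hi
    simp only [Profile.mk_fst_eq_true]
    rw [hi]
    exact id
  · intro i a hi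
    rw [Profile.mk_fst_eq_true, hi]
    exact id
  · intro i a hi
    rw [Profile.mk_fst_eq_true, hi]
    exact id
  · rintro μ ⟨h2, h3, h4, h5⟩ -
    have hsat : ∀ (Ψ : CPCTL AP) (hΨ : Ψ ∈ Φ.subformulas),
        μ ⟨Ψ, hΨ⟩ = true → M.HoldsWith s ν Ψ := by
      intro Ψ
      induction Ψ with
      | atom a => exact fun hΨ => h4 ⟨_, hΨ⟩ a rfl
      | natom a => exact fun hΨ => h5 ⟨_, hΨ⟩ a rfl
      | and A B ihA ihB =>
        intro hΨ hx
        have hA := CPCTL.subformulas_trans (CPCTL.and_left_mem_subformulas A B) hΨ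
        have hB := CPCTL.subformulas_trans (CPCTL.and_right_mem_subformulas A B) hΨ
        have h := h3 ⟨_, hΨ⟩ ⟨A, hA⟩ ⟨B, hB⟩ rfl hx
        exact ⟨ihA hA h.1, ihB hB h.2⟩
      | prob q A B => exact fun hΨ hx => h2 ⟨q, A, B, hΨ⟩ hx
    exact fun i => Bool.le_iff_imp.2 fun hi => Profile.mk_fst_eq_true.2 (hsat i.1 i.2 hi)

/-- The profiles of the truncated semantics are dominated by the value frontier. -/
theorem exists_mem_valueFrontier_ge {π : Policy Act} {leaf : History S → CPCTL AP → ℝ}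
    (hl : ∀ h Ψ, leaf h Ψ ∈ Set.Icc 0 1)
    (h0 : ∀ h, Profile.mk Φ (M.HoldsWith h.last (leaf h)) (leaf h) (hl h) ∈
      M.initialValue Φ h.last) (r : ℕ) (h : History S) :
    ∃ x ∈ M.valueFrontier Φ r h.last, Profile.mk Φ (M.TruncSat π leaf r h)
      (M.truncCounter π leaf r h) (M.truncCounter_mem_Icc π hl r h) ≤ x := by
  induction r generalizing h with
  | zero => exact ⟨_, h0 h, le_rfl⟩
  | succ r ih =>
    choose y hy hxy using fun s => ih (h.snoc s)
    rw [valueFrontier_succ]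
    -- The truncated recursion is by definition the Bellman recursion with `δ = π h`. The
    -- inequalities of `SubBellman` then allow the successor profiles to be raised to frontier
    -- elements.
    have h1 := M.bellmanCondition_mk (s := h.last) (Φ := Φ) (π h)
      (fun s => Profile.mk Φ (M.TruncSat π leaf r (h.snoc s)) (M.truncCounter π leaf r (h.snoc s))
        (M.truncCounter_mem_Icc π hl r (h.snoc s)))
      (e := fun Ψ => M.expect π (fun h' => M.truncCounter π leaf r h' Ψ) h)
      (M.truncCounter_mem_Icc π hl (r + 1) h) fun j => rfl
    obtain ⟨x', hx', h2⟩ := h1.subBellman.exists_le hxy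
    obtain ⟨z, hz, hxz⟩ := M.exists_mem_bellman_of_mem_closure
      (fun _ _ h => M.exists_mem_valueFrontier_of_mem_closure r h)
      (subset_closure ⟨π h, y, hy, h2⟩)
    exact ⟨z, hz, hx'.trans hxz⟩

theorem truncSat_of_mem_conjuncts {π : Policy Act} {leaf : History S → CPCTL AP → ℝ} {r : ℕ}
    {h : History S} {Ψ χ : CPCTL AP} (hΨ : M.TruncSat π leaf r h Ψ) (hχ : χ ∈ Ψ.conjuncts) :
    M.TruncSat π leaf r h χ := by
  induction Ψ with
  | atom a => rwa [Set.mem_singleton_iff.1 hχ]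
  | natom a => rwa [Set.mem_singleton_iff.1 hχ]
  | prob q A B => rwa [Set.mem_singleton_iff.1 hχ]
  | and A B ihA ihB =>
    rw [truncSat_and] at hΨ
    exact hχ.elim (ihA hΨ.1) (ihB hΨ.2)

end MDP

end Frontier

theorem mainTheorem2 {S AP : Type*} {Act : S → Type*} [Fintype S] [∀ s, Fintype (Act s)]
    [∀ s, Nonempty (Act s)] (M : MDP S Act AP) (Φ : CPCTL AP)
    (hSlater : M.GeneralizedSlater Φ) :
    ∃ n₀ : ℕ, ∃ x ∈ M.valueFrontier Φ n₀ M.init,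
      ∀ j : PF Φ, j.formula ∈ Φ.conjuncts → j.thr ≤ x.2 j := by
  classical
  obtain ⟨d, hd, π, hπ⟩ := hSlater
  obtain ⟨ε, hε, hpol⟩ := M.exists_joint_policy Φ
  -- The policy may vary with the history at the horizon: the initial vector requires a common
  -- policy only within one profile, and the policy restarts at the last state.
  choose π' hπ' using hpol π
  set leaf : History S → CPCTL AP → ℝ := fun h Ψ =>
    if (M.induced (π' h)).Sat (.prob 1 (.globally Ψ.alit)) (.single h.last) then 1 else 0
    with hleaf
  have hl : ∀ h Ψ, leaf h Ψ ∈ Set.Icc 0 1 := fun h Ψ => by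
    simp only [hleaf]
    split_ifs <;> simp
  have hgood : M.GoodLeaf π ε Φ leaf := fun q A B hΨ hq h hA => if_pos (hπ' h q A B hΨ hq hA)
  have h0 : ∀ h, Profile.mk Φ (M.HoldsWith h.last (leaf h)) (leaf h) (hl h) ∈
      M.initialValue Φ h.last := fun h =>
    M.mk_mem_initialValue (hl h) (π' h) (fun _ h => if_pos h) (fun _ h => if_neg h)
  obtain ⟨r, hr⟩ := (M.eventually_truncSat π hl hε hgood (fun q A B h => hd ⟨q, A, B, h⟩)
    Φ.self_mem_subformulas (h := .single M.init) hπ).exists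
  obtain ⟨x, hx, hle⟩ := M.exists_mem_valueFrontier_ge hl h0 (π := π) r (.single M.init)
  refine ⟨r, x, hx, fun j hj => le_trans ?_ (hle.2 j)⟩
  exact (M.truncSat_prob π r _ j.thr j.left j.right).1 (M.truncSat_of_mem_conjuncts hr hj)
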